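/- Let $s\in\mathbb N$ be the space dimension, $m>0$, $\omega(q)=\sqrt{m^2+|q|^2}$ for $q\in\mathbb R^s$, and $D=-i\partial_u$ on $L^2(\mathbb R^s)$. For $p\in\mathbb R^s$ let $\omega_p(q)=\omega(p/2+q)+\omega(p/2-q)$, let $\omega_p(D)$ be the corresponding self-adjoint Fourier multiplier on $L^2(\mathbb R^s)$ (the energy of two free relativistic particles with total momentum $p$), and let $E_p$ be its spectral measure. Let $\varepsilon>0$ and $\beta\in\mathbb R$, and set $I_{p,\varepsilon}=[2\omega(p/2)+\varepsilon,\beta]$ (the empty set if $\beta<2\omega(p/2)+\varepsilon$). Let $\theta\in C_c^\infty((0,\infty);\mathbb R)$ satisfy $\theta=1$ on $(\varepsilon/2,\beta+1)$, let $$F_p(q)=\theta\bigl(\omega_p(q)-2\omega(p/2)\bigr)\,\frac{\nabla\omega_p(q)}{|\nabla\omega_p(q)|^2},$$ which is understood to be $0$ at $q=0$, and let $A_p$ be the self-adjoint closure of the operator $\tfrac12\bigl(F_p(D)\cdot u+u\cdot F_p(D)\bigr)$ defined on the Schwartz space $\mathcal S(\mathbb R^s)$, where $u$ is multiplication by the coordinate.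 Write $\langle x\rangle=\sqrt{1+|x|^2}$. Lemma. For every $\nu>1/2$ there is a function $c:\mathbb R^s\to[0,\infty)$ such that, for all $p\in\mathbb R^s$ and all $f\in L^2(\mathbb R^s)$, $$\int_{-\infty}^{\infty}\bigl\|\langle A_p\rangle^{-\nu}e^{i\tau\omega_p(D)}E_p(I_{p,\varepsilon})f\bigr\|_{L^2}^2\,d\tau\le c(p)\,\|f\|_{L^2}^2,$$ and $\sup_{p\in K}c(p)<\infty$ for every compact set $K\subset\mathbb R^s$. -/

import Mathlib

open MeasureTheory Set Real
open scoped FourierTransform SchwartzMap Gradient ContDiff ENNReal NNReal InnerProductSpace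

noncomputable section

namespace TwoParticle

/-! ### The operator `⟨A⟩^{-ν}` for a (closable, densely defined) unbounded operator `A` -/

section JapaneseBracket

variable {H : Type*} [NormedAddCommGroup H] [InnerProductSpace ℂ H] [CompleteSpace H]

/-- The closure of the graph of `A`, in the Hilbert space `H ⊕ H`. If `A` is closable, this is the
graph of the operator closure of `A`. -/
def closedGraph (A : H →ₗ.[ℂ] H) : Submodule ℂ (WithLp 2 (H × H)) :=
  (A.graph.map (WithLp.linearEquiv 2 ℂ (H × H)).symm.toLinearMap).topologicalClosure

instance (A : H →ₗ.[ℂ] H) : CompleteSpace (closedGraph A) :=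
  inferInstanceAs (CompleteSpace (Submodule.topologicalClosure _))

/-- The bounded operator `(1 + A̅* A̅)⁻¹`, where `A̅` is the closure of `A`. It maps `f` to the first
component of the orthogonal projection of `(f, 0)` onto the graph of `A̅`. If `A̅` is self-adjoint,
it is `(1 + A̅ ^ 2)⁻¹` (see `resolventSq_apply`). -/
def resolventSq (A : H →ₗ.[ℂ] H) : H →L[ℂ] H :=
  (WithLp.fstL 2 ℂ H H) ∘L (closedGraph A).starProjection ∘L
    ((WithLp.prodContinuousLinearEquiv 2 ℂ H H).symm : H × H →L[ℂ] WithLp 2 (H × H)) ∘L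
      (ContinuousLinearMap.inl ℂ H H)

/-- `⟨A̅⟩^{-ν}`, where `⟨x⟩ = (1 + |x| ^ 2) ^ (1 / 2)`: the power `ν / 2` of the bounded positive
operator `(1 + A̅* A̅)⁻¹` in the continuous functional calculus (for `ν ≥ 0`). If `A̅` is
self-adjoint, this is `(1 + A̅ ^ 2) ^ (-ν / 2)`. -/
def japaneseNegPow (A : H →ₗ.[ℂ] H) (ν : ℝ) : H →L[ℂ] H :=
  cfc (fun x : ℝ => x ^ (ν / 2)) (resolventSq A)


theorem inner_resolventSq (A : H →ₗ.[ℂ] H) (f g : H) :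
    ⟪resolventSq A f, g⟫_ℂ =
      ⟪(closedGraph A).starProjection (WithLp.toLp 2 (f, 0)), WithLp.toLp 2 (g, 0)⟫_ℂ := by
  simp [resolventSq, WithLp.prod_inner_apply]

/-- `resolventSq A` is a positive operator, so `japaneseNegPow` is a genuine functional calculus. -/
theorem resolventSq_isPositive (A : H →ₗ.[ℂ] H) : (resolventSq A).IsPositive := by
  refine (ContinuousLinearMap.isPositive_iff_complex _).2 fun f => ?_
  rw [inner_resolventSq]
  refine (ContinuousLinearMap.isPositive_iff_complex (closedGraph A).starProjection).1 ?_ _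
  have h := (ContinuousLinearMap.isPositive_one (𝕜 := ℂ)
    (E := WithLp 2 (H × H))).conj_starProjection (closedGraph A)
  have e : (closedGraph A).starProjection ∘L (1 : WithLp 2 (H × H) →L[ℂ] WithLp 2 (H × H)) ∘L
      (closedGraph A).starProjection = (closedGraph A).starProjection := by
    ext1 x
    simpa using Submodule.starProjection_eq_self_iff.2
      (Submodule.starProjection_apply_mem (closedGraph A) x)
  rwa [e] at h

/-- If the closure of `A` is symmetric, `x` is in the domain of its square, with
`A̅ x = y` and `A̅ y = z`, then `resolventSq A` maps `(1 + A̅ ^ 2) x` to `x`. -/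
theorem resolventSq_apply (A : H →ₗ.[ℂ] H)
    (hA : ∀ a ∈ closedGraph A, ∀ b ∈ closedGraph A, ⟪a.snd, b.fst⟫_ℂ = ⟪a.fst, b.snd⟫_ℂ)
    (x y z : H) (hx : WithLp.toLp 2 (x, y) ∈ closedGraph A)
    (hy : WithLp.toLp 2 (y, z) ∈ closedGraph A) :
    resolventSq A (x + z) = x := by
  have h : (closedGraph A).starProjection (WithLp.toLp 2 (x + z, 0)) = WithLp.toLp 2 (x, y) := by
    refine Submodule.eq_starProjection_of_mem_of_inner_eq_zero hx fun w hw => ?_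
    have h := hA _ hy w hw
    simp only [WithLp.prod_inner_apply, WithLp.ofLp_sub, Prod.fst_sub, Prod.snd_sub,
      add_sub_cancel_left, zero_sub, inner_neg_left]
    exact add_neg_eq_zero.2 h
  simp [resolventSq, h]

end JapaneseBracket

/-! ### Fourier multipliers `g(D)`, `D = -i∂`, on `L²(ℝˢ)` -/

/-- The Hilbert space `L²(ℝˢ)`. -/
abbrev L2 (s : ℕ) : Type := Lp ℂ 2 (volume : Measure (EuclideanSpace ℝ (Fin s)))

variable {s : ℕ}

theorem memLp_dilated {g : EuclideanSpace ℝ (Fin s) → ℂ} (hg : Measurable g)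
    (hb : ∃ C : ℝ, ∀ q, ‖g q‖ ≤ C) :
    MemLp (fun ξ : EuclideanSpace ℝ (Fin s) => g ((2 * π) • ξ)) ∞ volume := by
  obtain ⟨C, hC⟩ := hb
  exact memLp_top_of_bound (hg.comp (measurable_const_smul _)).aestronglyMeasurable C
    (Filter.Eventually.of_forall fun ξ => hC _)

/-- The operator `g(D) = 𝓕⁻¹ g 𝓕` on `L²(ℝˢ)` for a bounded Borel function `g`. Mathlib's Fourier
transform is `𝓕 f ξ = ∫ exp (-2πi⟨x, ξ⟩) f x dx`, so `D = -i∂` is multiplication by `2πξ`. -/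
def fourierMul (g : EuclideanSpace ℝ (Fin s) → ℂ) (hg : Measurable g)
    (hb : ∃ C : ℝ, ∀ q, ‖g q‖ ≤ C) : L2 s →L[ℂ] L2 s :=
  ((Lp.fourierTransformₗᵢ (EuclideanSpace ℝ (Fin s)) ℂ).symm.toContinuousLinearEquiv :
      L2 s →L[ℂ] L2 s) ∘L
    ((ContinuousLinearMap.mul ℂ ℂ).holderL volume ∞ 2 2 ((memLp_dilated hg hb).toLp _)) ∘L
    ((Lp.fourierTransformₗᵢ (EuclideanSpace ℝ (Fin s)) ℂ).toContinuousLinearEquiv :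
      L2 s →L[ℂ] L2 s)

/-! ### The two-particle energy at fixed total momentum -/

/-- The relativistic dispersion relation `ω(q) = √(m² + |q|²)`. -/
def omega (m : ℝ) (q : EuclideanSpace ℝ (Fin s)) : ℝ := √(m ^ 2 + ‖q‖ ^ 2)

/-- `ω_p(q) = ω(p/2 + q) + ω(p/2 - q)`. -/
def omegaP (m : ℝ) (p q : EuclideanSpace ℝ (Fin s)) : ℝ :=
  omega m ((1 / 2 : ℝ) • p + q) + omega m ((1 / 2 : ℝ) • p - q)

theorem continuous_omegaP (m : ℝ) (p : EuclideanSpace ℝ (Fin s)) : Continuous (omegaP m p) := by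
  unfold omegaP omega
  fun_prop

/-- The Borel functional calculus of the self-adjoint operator `ω_p(D)`: the bounded operator
`φ(ω_p(D))` is the Fourier multiplier `(φ ∘ ω_p)(D)`. -/
def energyCalculus (m : ℝ) (p : EuclideanSpace ℝ (Fin s)) (φ : ℝ → ℂ) (hφ : Measurable φ)
    (hb : ∃ C : ℝ, ∀ x, ‖φ x‖ ≤ C) : L2 s →L[ℂ] L2 s :=
  fourierMul (fun q => φ (omegaP m p q)) (hφ.comp (continuous_omegaP m p).measurable)
    (hb.imp fun _ h q => h (omegaP m p q))

/-- The unitary operator `exp(iτ ω_p(D))`. -/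
def energyGroup (m : ℝ) (p : EuclideanSpace ℝ (Fin s)) (τ : ℝ) : L2 s →L[ℂ] L2 s :=
  energyCalculus m p (fun x => Complex.exp (Complex.I * τ * x)) (by fun_prop)
    ⟨1, fun x => by simp [Complex.norm_exp]⟩

/-- The spectral measure `E_p` of `ω_p(D)`: the spectral projection `E_p(I) = 1_I(ω_p(D))`. -/
def energyProj (m : ℝ) (p : EuclideanSpace ℝ (Fin s)) (I : Set ℝ) (hI : MeasurableSet I) :
    L2 s →L[ℂ] L2 s :=
  energyCalculus m p (I.indicator 1) (measurable_one.indicator hI)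
    ⟨1, fun x => by by_cases h : x ∈ I <;> simp [h]⟩

/-! ### The modified dilation operator `A_p` -/

/-- The vector field `F_p(q) = θ_p(ω_p(q)) ∇ω_p(q) / |∇ω_p(q)|²` with
`θ_p(λ) = θ(λ - 2 ω(p/2))`. -/
def vectorField (m : ℝ) (θ : ℝ → ℝ) (p q : EuclideanSpace ℝ (Fin s)) :
    EuclideanSpace ℝ (Fin s) :=
  (θ (omegaP m p q - 2 * omega m ((1 / 2 : ℝ) • p)) / ‖∇ (omegaP m p) q‖ ^ 2) • ∇ (omegaP m p) q

/-- The operator `F_{p,j}(D)` on the Schwartz space. -/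
def vectorFieldMul (m : ℝ) (θ : ℝ → ℝ) (p : EuclideanSpace ℝ (Fin s)) (j : Fin s) :
    𝓢(EuclideanSpace ℝ (Fin s), ℂ) →L[ℂ] 𝓢(EuclideanSpace ℝ (Fin s), ℂ) :=
  SchwartzMap.fourierMultiplierCLM ℂ fun ξ : EuclideanSpace ℝ (Fin s) =>
    ((vectorField m θ p ((2 * π) • ξ) j : ℝ) : ℂ)

/-- Multiplication by the coordinate `u_j` on the Schwartz space. -/
def coordMul (j : Fin s) :
    𝓢(EuclideanSpace ℝ (Fin s), ℂ) →L[ℂ] 𝓢(EuclideanSpace ℝ (Fin s), ℂ) :=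
  SchwartzMap.smulLeftCLM ℂ fun u : EuclideanSpace ℝ (Fin s) => ((u j : ℝ) : ℂ)

/-- `(F_p(D) · u + u · F_p(D)) / 2` as an operator on the Schwartz space. -/
def dilationSchwartz (m : ℝ) (θ : ℝ → ℝ) (p : EuclideanSpace ℝ (Fin s)) :
    𝓢(EuclideanSpace ℝ (Fin s), ℂ) →L[ℂ] 𝓢(EuclideanSpace ℝ (Fin s), ℂ) :=
  (1 / 2 : ℂ) • ∑ j : Fin s,
    (vectorFieldMul m θ p j ∘L coordMul j + coordMul j ∘L vectorFieldMul m θ p j)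

/-- The unbounded operator `(F_p(D) · u + u · F_p(D)) / 2` on `L²(ℝˢ)` with domain the Schwartz
space. The self-adjoint operator `A_p` is its closure. -/
def dilation (m : ℝ) (θ : ℝ → ℝ) (p : EuclideanSpace ℝ (Fin s)) : L2 s →ₗ.[ℂ] L2 s where
  domain := LinearMap.range
    (SchwartzMap.toLpCLM ℂ (E := EuclideanSpace ℝ (Fin s)) ℂ 2 volume).toLinearMap
  toFun := (SchwartzMap.toLpCLM ℂ (E := EuclideanSpace ℝ (Fin s)) ℂ 2 volume).toLinearMap ∘ₗ
    (dilationSchwartz m θ p).toLinearMap ∘ₗ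
    (LinearEquiv.ofInjective
      (SchwartzMap.toLpCLM ℂ (E := EuclideanSpace ℝ (Fin s)) ℂ 2 volume).toLinearMap
      (SchwartzMap.injective_toLp 2 volume)).symm.toLinearMap

theorem dilation_apply (m : ℝ) (θ : ℝ → ℝ) (p : EuclideanSpace ℝ (Fin s))
    (f : 𝓢(EuclideanSpace ℝ (Fin s), ℂ)) (hf : f.toLp 2 volume ∈ (dilation m θ p).domain) :
    dilation m θ p ⟨f.toLp 2 volume, hf⟩ = (dilationSchwartz m θ p f).toLp 2 volume := by
  have : (LinearEquiv.ofInjective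
      (SchwartzMap.toLpCLM ℂ (E := EuclideanSpace ℝ (Fin s)) ℂ 2 volume).toLinearMap
      (SchwartzMap.injective_toLp 2 volume)).symm ⟨f.toLp 2 volume, hf⟩ = f := by
    rw [LinearEquiv.symm_apply_eq]
    rfl
  simp only [dilation, LinearPMap.mk_apply, LinearMap.comp_apply, LinearEquiv.coe_coe, this]
  rfl

theorem omega_pos {m : ℝ} (hm : 0 < m) (q : EuclideanSpace ℝ (Fin s)) : 0 < omega m q := by
  unfold omega; positivity

theorem hasGradientAt_omega {m : ℝ} (hm : 0 < m) (q : EuclideanSpace ℝ (Fin s)) :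
    HasGradientAt (omega m) ((omega m q)⁻¹ • q) q := by
  rw [hasGradientAt_iff_hasFDerivAt]
  have h1 : HasFDerivAt (fun q : EuclideanSpace ℝ (Fin s) => m ^ 2 + ‖q‖ ^ 2)
      (2 • innerSL ℝ q) q := ((hasStrictFDerivAt_norm_sq q).hasFDerivAt).const_add _
  have h2 := h1.sqrt (by positivity)
  refine h2.congr_fderiv ?_
  ext v
  have := (omega_pos hm q).ne'
  simp [omega] at this ⊢
  field_simp

theorem gradient_omegaP {m : ℝ} (hm : 0 < m) (p q : EuclideanSpace ℝ (Fin s)) :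
    ∇ (omegaP m p) q = (omega m ((1 / 2 : ℝ) • p + q))⁻¹ • ((1 / 2 : ℝ) • p + q) -
      (omega m ((1 / 2 : ℝ) • p - q))⁻¹ • ((1 / 2 : ℝ) • p - q) := by
  apply HasGradientAt.gradient
  have h1 := (hasGradientAt_omega hm ((1 / 2 : ℝ) • p + q)).hasFDerivAt.comp q
    ((hasFDerivAt_id q).const_add ((1 / 2 : ℝ) • p))
  have h2 := (hasGradientAt_omega hm ((1 / 2 : ℝ) • p - q)).hasFDerivAt.comp q
    ((hasFDerivAt_id q).const_sub ((1 / 2 : ℝ) • p))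
  rw [hasGradientAt_iff_hasFDerivAt]
  refine (h1.add h2).congr_fderiv ?_
  ext v
  simp
  ring

theorem contDiff_omega {m : ℝ} (hm : 0 < m) :
    ContDiff ℝ ∞ (omega m : EuclideanSpace ℝ (Fin s) → ℝ) := by
  unfold omega
  exact (contDiff_const.add (contDiff_norm_sq ℝ)).sqrt fun q => by positivity

theorem gradient_omegaP_ne_zero {m : ℝ} (hm : 0 < m) (p : EuclideanSpace ℝ (Fin s))
    {q : EuclideanSpace ℝ (Fin s)} (hq : q ≠ 0) : ∇ (omegaP m p) q ≠ 0 := by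
  rw [gradient_omegaP hm]
  intro h
  set a := (1 / 2 : ℝ) • p + q with ha
  set b := (1 / 2 : ℝ) • p - q with hb
  have hoa := omega_pos hm a
  have hob := omega_pos hm b
  have h1 : (omega m a)⁻¹ • a = (omega m b)⁻¹ • b := sub_eq_zero.1 h
  have h2 := congrArg (fun v => ‖v‖ ^ 2) h1
  simp only [norm_smul, norm_inv, norm_eq_abs, abs_of_pos hoa, abs_of_pos hob, mul_pow,
    inv_pow] at h2
  have ea : omega m a ^ 2 = m ^ 2 + ‖a‖ ^ 2 := sq_sqrt (by positivity)
  have eb : omega m b ^ 2 = m ^ 2 + ‖b‖ ^ 2 := sq_sqrt (by positivity)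
  rw [ea, eb] at h2
  have hpa : 0 < m ^ 2 + ‖a‖ ^ 2 := by positivity
  have hpb : 0 < m ^ 2 + ‖b‖ ^ 2 := by positivity
  field_simp at h2
  have h3 : ‖a‖ ^ 2 = ‖b‖ ^ 2 := by nlinarith [pow_pos hm 2]
  have h4 : omega m a = omega m b := by unfold omega; rw [h3]
  rw [h4] at h1
  have h5 : a = b := smul_right_injective _ (inv_ne_zero hob.ne') h1
  apply hq
  have h6 : q + q = 0 := by
    have : a - b = q + q := by rw [ha, hb]; abel
    rw [← this, h5, sub_self]
  rw [← two_smul ℝ] at h6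
  simpa using h6

/-- For the cut-off functions `θ ∈ C_c^∞(0, ∞)`, the vector field `F_p` is smooth. -/
theorem contDiff_vectorField {m : ℝ} (hm : 0 < m) {θ : ℝ → ℝ} (hθ : ContDiff ℝ ∞ θ)
    (hθs : tsupport θ ⊆ Ioi 0) (p : EuclideanSpace ℝ (Fin s)) :
    ContDiff ℝ ∞ (vectorField m θ p) := by
  have hE : ContDiff ℝ ∞ (omegaP m p) :=
    ((contDiff_omega hm).comp (contDiff_const.add contDiff_id)).add
      ((contDiff_omega hm).comp (contDiff_const.sub contDiff_id))
  have hG : ContDiff ℝ ∞ (∇ (omegaP m p)) := by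
    have : ∇ (omegaP m p) = _ := funext (gradient_omegaP hm p)
    rw [this]
    have hp : ContDiff ℝ ∞ fun q : EuclideanSpace ℝ (Fin s) => (1 / 2 : ℝ) • p + q :=
      contDiff_const.add contDiff_id
    have hn : ContDiff ℝ ∞ fun q : EuclideanSpace ℝ (Fin s) => (1 / 2 : ℝ) • p - q :=
      contDiff_const.sub contDiff_id
    exact ((((contDiff_omega hm).comp hp).inv fun q => (omega_pos hm _).ne').smul hp).sub
      ((((contDiff_omega hm).comp hn).inv fun q => (omega_pos hm _).ne').smul hn)
  rw [contDiff_iff_contDiffAt]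
  intro q
  by_cases hq : q = 0
  · have h0 : (omegaP m p q - 2 * omega m ((1 / 2 : ℝ) • p)) ∉ tsupport θ := by
      intro h
      have := hθs h
      simp [hq, omegaP, two_mul] at this
    have hev : vectorField m θ p =ᶠ[nhds q] fun _ => 0 := by
      have hc : ContinuousAt (fun q => omegaP m p q - 2 * omega m ((1 / 2 : ℝ) • p)) q :=
        ((continuous_omegaP m p).sub continuous_const).continuousAt
      filter_upwards [hc.eventually ((isClosed_tsupport θ).isOpen_compl.mem_nhds h0)] with x hx
      rw [vectorField, image_eq_zero_of_notMem_tsupport hx, zero_div, zero_smul]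
    exact contDiffAt_const.congr_of_eventuallyEq hev
  · have hne := gradient_omegaP_ne_zero hm p hq
    unfold vectorField
    refine ContDiffAt.smul (ContDiffAt.div ?_ (hG.contDiffAt.norm_sq ℝ) (by simpa using hne))
      hG.contDiffAt
    exact (hθ.comp (hE.sub contDiff_const)).contDiffAt

theorem norm_le_omegaP (m : ℝ) (p q : EuclideanSpace ℝ (Fin s)) : ‖q‖ ≤ omegaP m p q := by
  have h (x : EuclideanSpace ℝ (Fin s)) : ‖x‖ ≤ omega m x :=
    le_sqrt_of_sq_le (by nlinarith [sq_nonneg m])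
  have h1 := h ((1 / 2 : ℝ) • p + q)
  have h2 := h ((1 / 2 : ℝ) • p - q)
  have h3 := norm_sub_le ((1 / 2 : ℝ) • p + q) ((1 / 2 : ℝ) • p - q)
  have h4 : (1 / 2 : ℝ) • p + q - ((1 / 2 : ℝ) • p - q) = (2 : ℝ) • q := by
    rw [two_smul]; abel
  rw [h4, norm_smul, norm_ofNat] at h3
  unfold omegaP
  linarith [norm_nonneg q]

/-- For the cut-off functions `θ ∈ C_c^∞(0, ∞)`, the vector field `F_p` has compact support. -/
theorem hasCompactSupport_vectorField (m : ℝ) {θ : ℝ → ℝ} (hθc : HasCompactSupport θ)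
    (p : EuclideanSpace ℝ (Fin s)) : HasCompactSupport (vectorField m θ p) := by
  obtain ⟨R, hR⟩ := hθc.isCompact.isBounded.subset_closedBall 0
  refine HasCompactSupport.intro (isCompact_closedBall (0 : EuclideanSpace ℝ (Fin s))
    (R + 2 * omega m ((1 / 2 : ℝ) • p))) fun q hq => ?_
  have : θ (omegaP m p q - 2 * omega m ((1 / 2 : ℝ) • p)) = 0 := by
    apply image_eq_zero_of_notMem_tsupport
    intro h
    have h1 := hR h
    simp only [Metric.mem_closedBall, dist_zero_right, norm_eq_abs, not_le] at h1 hq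
    linarith [le_abs_self (omegaP m p q - 2 * omega m ((1 / 2 : ℝ) • p)), norm_le_omegaP m p q]
  rw [vectorField, this, zero_div, zero_smul]

/-- The multipliers in `vectorFieldMul` are admissible: `F_{p,j}(D)` maps the Schwartz space to
itself. -/
theorem vectorFieldMul_hasTemperateGrowth {m : ℝ} (hm : 0 < m) {θ : ℝ → ℝ}
    (hθ : ContDiff ℝ ∞ θ) (hθc : HasCompactSupport θ) (hθs : tsupport θ ⊆ Ioi 0)
    (p : EuclideanSpace ℝ (Fin s)) (j : Fin s) :
    Function.HasTemperateGrowth fun ξ : EuclideanSpace ℝ (Fin s) =>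
      ((vectorField m θ p ((2 * π) • ξ) j : ℝ) : ℂ) := by
  have h1 : HasCompactSupport fun q => ((vectorField m θ p q j : ℝ) : ℂ) :=
    (hasCompactSupport_vectorField m hθc p).comp_left 
      (g := fun v : EuclideanSpace ℝ (Fin s) => ((v j : ℝ) : ℂ)) (by simp)
  have h2 : HasCompactSupport fun ξ : EuclideanSpace ℝ (Fin s) =>
      ((vectorField m θ p ((2 * π) • ξ) j : ℝ) : ℂ) :=
    h1.comp_homeomorph (Homeomorph.smulOfNeZero (2 * π) (by positivity))
  have h3 : ContDiff ℝ ∞ fun ξ : EuclideanSpace ℝ (Fin s) =>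
      ((vectorField m θ p ((2 * π) • ξ) j : ℝ) : ℂ) := by
    have h4 : ContDiff ℝ ∞ fun ξ : EuclideanSpace ℝ (Fin s) =>
        vectorField m θ p ((2 * π) • ξ) :=
      (contDiff_vectorField hm hθ hθs p).comp (contDiff_const_smul (2 * π))
    exact Complex.ofRealCLM.contDiff.comp
      ((EuclideanSpace.proj j : EuclideanSpace ℝ (Fin s) →L[ℝ] ℝ).contDiff.comp h4)
  exact (h2.toSchwartzMap h3).hasTemperateGrowth

end TwoParticle

end

/-! Write H = ω_p(D), E for its spectral measure, and A for the closure of the dilation operator.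
The proof combines a commutator bound on short energy intervals, an interpolation in A, and Kato's
smoothness criterion.

The field F_p is normalised so that F_p·∇ω_p = θ(ω_p − 2ω(p/2)). Hence on Schwartz functions [A,
ψ(H)] = i ψ'(H) θ(H − 2ω(p/2)), again a function of H. For J inside an interval of radius δ on which
the shifted θ equals 1, let ψ' be a bump around J times the shifted θ: the commutator, up to the
factor i, dominates E(J), while ψ itself is only O(δ). Since A is symmetric, expanding the
commutator gives ‖E(J)x‖² ≤ 8Mδ‖x‖‖Ax‖ with M a bound for |θ| (`norm_energyProj_fst_sq_le`).

This bound is of order 1/2 in A. Decomposing (1 + A*A)⁻¹ into pieces of spectral size 4⁻ᵏ and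
summing a geometric series turns it into ‖E(J)⟨A⟩^{-ν}‖ ≤ C√δ for every ν > 1/2
(`exists_norm_comp_japaneseNegPow_le`).

Finally, round the energy down to a grid of width δ. The evolution becomes a trigonometric
polynomial in τ, and Parseval over one period 2π/δ produces a factor 1/δ that the squared bound C²δ
cancels. Fatou's lemma as δ → 0 finishes (`lintegral_norm_evolution_le`). No constant depends on p,
so c can be taken constant and local boundedness is immediate. -/

namespace TwoParticle

/-! ### Interpolation: from a bound by ‖x‖‖Ax‖ to a bound on E⟨A⟩^{-ν} -/

section Interpolation

variable {H : Type*} [NormedAddCommGroup H] [InnerProductSpace ℂ H] [CompleteSpace H]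

theorem resolventSq_eq_fst (A : H →ₗ.[ℂ] H) (f : H) :
    resolventSq A f = ((closedGraph A).starProjection (WithLp.toLp 2 (f, 0))).fst := by
  simp [resolventSq]

theorem re_inner_resolventSq (A : H →ₗ.[ℂ] H) (f : H) :
    (⟪resolventSq A f, f⟫_ℂ).re =
      ‖(closedGraph A).starProjection (WithLp.toLp 2 (f, 0))‖ ^ 2 := by
  have h := Submodule.starProjection_eq_self_iff.2
    (Submodule.starProjection_apply_mem (closedGraph A) (WithLp.toLp 2 (f, 0)))
  have h' := Submodule.inner_starProjection_left_eq_right (closedGraph A)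
    ((closedGraph A).starProjection (WithLp.toLp 2 (f, 0))) (WithLp.toLp 2 (f, 0))
  rw [h] at h'
  rw [inner_resolventSq, h']
  exact inner_self_eq_norm_sq (𝕜 := ℂ)
    ((closedGraph A).starProjection (WithLp.toLp 2 (f, 0)))

/-- The projection of (f, 0) onto the closed graph is (Rf, A̅Rf) with R = `resolventSq A`, and its
squared norm is ⟨Rf, f⟩. Thus A̅Rf is controlled by R alone, and the interpolation needs only the
functional calculus of R. -/
theorem norm_snd_starProjection_le (A : H →ₗ.[ℂ] H) (f : H) :
    ‖((closedGraph A).starProjection (WithLp.toLp 2 (f, 0))).snd‖ ≤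
      √(⟪resolventSq A f, f⟫_ℂ).re := by
  rw [re_inner_resolventSq, sqrt_sq (norm_nonneg _)]
  exact WithLp.norm_snd_le _ _

theorem norm_resolventSq_le (A : H →ₗ.[ℂ] H) : ‖resolventSq A‖ ≤ 1 := by
  refine ContinuousLinearMap.opNorm_le_bound _ zero_le_one fun f => ?_
  rw [resolventSq_eq_fst, one_mul]
  calc _ ≤ ‖(closedGraph A).starProjection (WithLp.toLp 2 (f, 0))‖ := WithLp.norm_fst_le _ _
    _ ≤ ‖(WithLp.toLp 2 (f, 0) : WithLp 2 (H × H))‖ :=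
      (closedGraph A).norm_starProjection_apply_le _
    _ = ‖f‖ := by simp

theorem spectrum_resolventSq_subset (A : H →ₗ.[ℂ] H) :
    spectrum ℝ (resolventSq A) ⊆ Icc 0 1 := by
  intro x hx
  have h0 : 0 ≤ resolventSq A :=
    (ContinuousLinearMap.nonneg_iff_isPositive _).2 (resolventSq_isPositive A)
  refine ⟨spectrum_nonneg_of_nonneg h0 hx, ?_⟩
  rcases subsingleton_or_nontrivial H with hH | hH
  · have : Subsingleton (H →L[ℂ] H) := inferInstance
    exact absurd hx (by simp [spectrum.of_subsingleton])
  · exact (le_abs_self x).trans ((spectrum.norm_le_norm_of_mem hx).trans (norm_resolventSq_le A))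

/-- Apply `hE` to h(R)v. The two factors on the right are then bounded by ‖R h(R)‖ ≤ b and by the
square root of ‖R h(R)²‖ ≤ d². -/
theorem norm_comp_cfc_mul_le {R E : H →L[ℂ] H} (hR : IsSelfAdjoint R)
    (hs : spectrum ℝ R ⊆ Icc 0 1) {a : ℝ} (ha : 0 ≤ a)
    (hE : ∀ v, ‖E (R v)‖ ^ 2 ≤ a * (‖R v‖ * √(⟪R v, v⟫_ℂ).re))
    {h : ℝ → ℝ} (hc : ContinuousOn h (Icc 0 1)) {b d : ℝ} (hb0 : 0 ≤ b) (hd0 : 0 ≤ d)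
    (hb : ∀ x ∈ Icc (0 : ℝ) 1, |x * h x| ≤ b) (hd : ∀ x ∈ Icc (0 : ℝ) 1, x * h x ^ 2 ≤ d ^ 2) :
    ‖E ∘L cfc (fun x => x * h x) R‖ ≤ √(a * (b * d)) := by
  have hc' : ContinuousOn h (spectrum ℝ R) := hc.mono hs
  have e1 : cfc (fun x => x * h x) R = R * cfc h R := by
    rw [cfc_mul (fun x => x) h R, cfc_id' ℝ R]
  have hsa : IsSelfAdjoint (cfc h R) := cfc_predicate h R
  refine ContinuousLinearMap.opNorm_le_bound _ (sqrt_nonneg _) fun v => ?_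
  have h1 : ‖R (cfc h R v)‖ ≤ b * ‖v‖ := by
    have : ‖cfc (fun x => x * h x) R‖ ≤ b := norm_cfc_le hb0 fun x hx => hb x (hs hx)
    rw [e1] at this
    exact (R * cfc h R).le_of_opNorm_le this v
  have h2 : (⟪R (cfc h R v), cfc h R v⟫_ℂ).re ≤ (d * ‖v‖) ^ 2 := by
    have e2 : cfc (fun x => x * h x ^ 2) R = cfc h R * (R * cfc h R) := by
      rw [← e1, ← cfc_mul h (fun x => x * h x) R]
      congr 1
      ext x
      ring
    have : ‖cfc (fun x => x * h x ^ 2) R‖ ≤ d ^ 2 := norm_cfc_le (by positivity) fun x hx => by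
      rw [norm_eq_abs, abs_of_nonneg (mul_nonneg (hs hx).1 (sq_nonneg _))]
      exact hd x (hs hx)
    rw [e2] at this
    have e3 : ⟪R (cfc h R v), cfc h R v⟫_ℂ = ⟪(cfc h R * (R * cfc h R)) v, v⟫_ℂ := by
      have := ContinuousLinearMap.adjoint_inner_left (cfc h R) v (R (cfc h R v))
      rw [← ContinuousLinearMap.star_eq_adjoint, hsa.star_eq] at this
      exact this.symm
    rw [e3]
    calc _ ≤ ‖⟪(cfc h R * (R * cfc h R)) v, v⟫_ℂ‖ := Complex.re_le_norm _
      _ ≤ ‖(cfc h R * (R * cfc h R)) v‖ * ‖v‖ := norm_inner_le_norm _ _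
      _ ≤ (d ^ 2 * ‖v‖) * ‖v‖ := by
        gcongr
        exact ContinuousLinearMap.le_of_opNorm_le _ this v
      _ = _ := by ring
  have h3 : √(⟪R (cfc h R v), cfc h R v⟫_ℂ).re ≤ d * ‖v‖ := sqrt_le_iff.2 ⟨by positivity, h2⟩
  have h4 : ‖E (R (cfc h R v))‖ ^ 2 ≤ (√(a * (b * d)) * ‖v‖) ^ 2 := by
    refine (hE _).trans ?_
    rw [mul_pow, sq_sqrt (by positivity)]
    calc _ ≤ a * ((b * ‖v‖) * (d * ‖v‖)) := by gcongr
      _ = _ := by ring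
  rw [e1]
  exact le_of_sq_le_sq h4 (by positivity)

theorem rpow_le_of_mem_Icc {t y γ : ℝ} (ht : 0 < t) (hy : y ∈ Icc (t / 4) t) :
    y ^ γ ≤ 4 ^ |γ| * t ^ γ := by
  have hy0 : 0 < y := lt_of_lt_of_le (by positivity) hy.1
  have h1 : y ^ γ = (y / t) ^ γ * t ^ γ := by
    rw [div_rpow hy0.le ht.le, div_mul_cancel₀ _ (rpow_pos_of_pos ht _).ne']
  have h2 : y / t ≤ 1 := (div_le_one ht).2 hy.2
  have h3 : 1 / 4 ≤ y / t := by rw [le_div_iff₀ ht]; linarith [hy.1]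
  rw [h1]
  gcongr
  calc (y / t) ^ γ ≤ (y / t) ^ (-|γ|) :=
        rpow_le_rpow_of_exponent_ge (by positivity) h2 (neg_abs_le γ)
    _ ≤ (1 / 4) ^ (-|γ|) :=
        rpow_le_rpow_of_nonpos (by positivity) h3 (neg_nonpos.2 (abs_nonneg γ))
    _ = _ := by rw [one_div, inv_rpow (by norm_num), rpow_neg (by norm_num), inv_inv]

/-- The two truncations agree for x ≥ t; for x ≤ t both bases lie in [t/4, t], where y^γ is
comparable to t^γ whatever the sign of γ. -/
theorem abs_max_rpow_sub_le {t γ : ℝ} (ht : 0 < t) (x : ℝ) :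
    |max x (t / 4) ^ γ - max x t ^ γ| ≤ 4 ^ |γ| * t ^ γ := by
  rcases le_total t x with h | h
  · rw [max_eq_left h, max_eq_left (by linarith), sub_self, abs_zero]
    positivity
  · have h1 : max x t ^ γ ≤ 4 ^ |γ| * t ^ γ :=
      rpow_le_of_mem_Icc ht (by rw [max_eq_right h]; constructor <;> linarith)
    have h2 : max x (t / 4) ^ γ ≤ 4 ^ |γ| * t ^ γ :=
      rpow_le_of_mem_Icc ht ⟨le_max_right _ _, max_le h (by linarith)⟩
    have h3 : 0 ≤ max x t ^ γ := rpow_nonneg (ht.le.trans (le_max_right _ _)) _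
    have h4 : 0 ≤ max x (t / 4) ^ γ :=
      rpow_nonneg ((by positivity : 0 ≤ t / 4).trans (le_max_right _ _)) _
    rw [abs_le]
    constructor <;> linarith

theorem abs_mul_max_rpow_sub_le {t α x : ℝ} (ht : 0 < t) (hα : 0 < α) (hx : 0 ≤ x) :
    |x * max x t ^ (α - 1) - x ^ α| ≤ t ^ α := by
  rcases hx.eq_or_lt with rfl | hx0
  · rw [zero_rpow hα.ne', zero_mul, sub_zero, abs_zero]
    positivity
  rcases le_total t x with h | h
  · rw [max_eq_left h, rpow_sub_one hx0.ne', mul_div_cancel₀ _ hx0.ne', sub_self, abs_zero]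
    positivity
  · rw [max_eq_right h]
    have h1 : x * t ^ (α - 1) ≤ t ^ α := by
      calc _ ≤ t * t ^ (α - 1) := by gcongr
        _ = _ := by rw [rpow_sub_one ht.ne', mul_div_cancel₀ _ ht.ne']
    have h2 : x ^ α ≤ t ^ α := rpow_le_rpow hx h hα.le
    have h3 : 0 ≤ x * t ^ (α - 1) := by positivity
    have h4 : 0 ≤ x ^ α := by positivity
    rw [abs_le]
    constructor <;> linarith

theorem continuous_max_rpow {t : ℝ} (ht : 0 < t) (γ : ℝ) :
    Continuous fun x : ℝ => max x t ^ γ :=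
  (continuous_id.max continuous_const).rpow_const fun _ =>
    Or.inl (ht.trans_le (le_max_right _ _)).ne'

variable (H) in
/-- The endpoint embedding: the estimate `‖E x‖² ≤ a ‖x‖ ‖A x‖` implies that
`E (1 + A* A) ^ (-ν / 2)` is bounded by a multiple of `√a` for every `ν > 1 / 2`. -/
theorem exists_norm_comp_cfc_rpow_le {ν : ℝ} (hν : 1 / 2 < ν) :
    ∃ C : ℝ, 0 ≤ C ∧ ∀ (R E : H →L[ℂ] H), IsSelfAdjoint R → spectrum ℝ R ⊆ Icc 0 1 →
      ∀ a : ℝ, 0 ≤ a → (∀ v, ‖E (R v)‖ ^ 2 ≤ a * (‖R v‖ * √(⟪R v, v⟫_ℂ).re)) →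
        ‖E ∘L cfc (fun x : ℝ => x ^ (ν / 2)) R‖ ≤ C * √a := by
  -- The exponent is chosen so that x^(ν/2) = x · x^γ for x > 0; x^γ may be singular at 0 and is
  -- truncated below.
  set γ := ν / 2 - 1 with hγ
  set M : ℝ := 4 ^ |γ| with hM
  set r : ℝ := √((1 / 4) ^ (ν - 1 / 2)) with hr
  have hr0 : 0 ≤ r := sqrt_nonneg _
  have hr1 : r < 1 := by
    rw [hr, sqrt_lt' one_pos, one_pow]
    exact rpow_lt_one (by norm_num) (by norm_num) (by linarith)
  have hM0 : 0 ≤ M := by positivity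
  refine ⟨1 + M * (1 - r)⁻¹, ?_, fun R E hR hs a ha hE => ?_⟩
  · have : 0 ≤ (1 - r)⁻¹ := inv_nonneg.2 (by linarith)
    positivity
  let t : ℕ → ℝ := fun k => (1 / 4) ^ k
  have ht (k : ℕ) : 0 < t k := by positivity
  have ht1 (k : ℕ) : t (k + 1) = t k / 4 := by simp only [t, pow_succ]; ring
  -- Truncations of x^(ν/2) at the scale t k. Each has the form x · h(x) with h continuous, as
  -- `norm_comp_cfc_mul_le` requires, and they converge uniformly on [0, 1].
  let f : ℕ → ℝ → ℝ := fun k x => x * max x (t k) ^ γ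
  have hf (k : ℕ) : Continuous (f k) := continuous_id.mul (continuous_max_rpow (ht k) γ)
  have hstep (k : ℕ) : ‖E ∘L cfc (fun x => f (k + 1) x - f k x) R‖ ≤ √a * (M * r ^ k) := by
    have hc : Continuous fun x : ℝ => max x (t k / 4) ^ γ - max x (t k) ^ γ :=
      (continuous_max_rpow (by linarith [ht k]) γ).sub (continuous_max_rpow (ht k) γ)
    have hzero (x : ℝ) (hx : t k ≤ x) : max x (t k / 4) ^ γ - max x (t k) ^ γ = 0 := by
      rw [max_eq_left hx, max_eq_left (by linarith [ht k]), sub_self]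
    have hB : 0 ≤ M * t k ^ γ := by positivity
    have h := norm_comp_cfc_mul_le hR hs ha hE hc.continuousOn
      (b := t k * (M * t k ^ γ)) (d := √(t k) * (M * t k ^ γ)) (by positivity) (by positivity)
      (fun x hx => by
        rcases le_total (t k) x with h | h
        · rw [hzero x h, mul_zero, abs_zero]; positivity
        · rw [abs_mul, abs_of_nonneg hx.1]
          exact mul_le_mul h (abs_max_rpow_sub_le (ht k) x) (abs_nonneg _) (ht k).le)
      (fun x hx => by
        rcases le_total (t k) x with h | h
        · rw [hzero x h, zero_pow two_ne_zero, mul_zero]; positivity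
        · rw [mul_pow, sq_sqrt (ht k).le, ← sq_abs (_ - _)]
          have := abs_max_rpow_sub_le (γ := γ) (ht k) x
          gcongr)
    have e1 : (fun x => f (k + 1) x - f k x) =
        fun x => x * (max x (t k / 4) ^ γ - max x (t k) ^ γ) := by
      ext x
      simp only [f, ht1]
      ring
    -- The powers of t add up to 1 + 1/2 + 2γ = ν − 1/2, which is positive exactly when ν > 1/2;
    -- this makes the ratio r less than 1.
    have e2 : t k * (M * t k ^ γ) * (√(t k) * (M * t k ^ γ)) = (M * r ^ k) ^ 2 := by
      have h1 : t k * √(t k) * (t k ^ γ * t k ^ γ) = t k ^ (ν - 1 / 2) := by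
        rw [sqrt_eq_rpow, ← rpow_add (ht k), ← rpow_one_add' (ht k).le (by norm_num),
          ← rpow_add (ht k)]
        congr 1
        rw [hγ]; ring
      have h2 : (r ^ k) ^ 2 = t k ^ (ν - 1 / 2) := by
        rw [← pow_mul, mul_comm, pow_mul, hr, sq_sqrt (by positivity), ← rpow_natCast,
          ← rpow_mul (by norm_num), mul_comm, rpow_mul (by norm_num), rpow_natCast]
      rw [mul_pow, h2, ← h1]
      ring
    rw [e1]
    rwa [e2, sqrt_mul ha, sqrt_sq (by positivity)] at h
  -- Since t 0 = 1 bounds the spectrum, f 0 is the identity there.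
  have hzero : ‖E ∘L cfc (f 0) R‖ ≤ √a := by
    have h := norm_comp_cfc_mul_le hR hs ha hE (continuous_max_rpow (ht 0) γ).continuousOn
      (b := 1) (d := 1) zero_le_one zero_le_one
      (fun x hx => by
        rw [max_eq_right (by simpa [t] using hx.2)]
        simp [t, abs_of_nonneg hx.1, hx.2])
      (fun x hx => by
        rw [max_eq_right (by simpa [t] using hx.2)]
        simp [t, hx.2])
    simpa using h
  have hsum (k : ℕ) : ‖E ∘L cfc (f k) R‖ ≤ √a * (1 + M * ∑ j ∈ Finset.range k, r ^ j) := by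
    induction k with
    | zero => simpa using hzero
    | succ k ih =>
      have e : cfc (f (k + 1)) R = cfc (f k) R + cfc (fun x => f (k + 1) x - f k x) R := by
        rw [cfc_sub (f (k + 1)) (f k) R (hf _).continuousOn (hf _).continuousOn]
        abel
      rw [e, ContinuousLinearMap.comp_add, Finset.sum_range_succ]
      refine (norm_add_le _ _).trans ((add_le_add ih (hstep k)).trans_eq ?_)
      ring
  have hα : 0 < ν / 2 := by linarith
  have hlim : Filter.Tendsto (fun k => (1 + M * (1 - r)⁻¹) * √a + ‖E‖ * t k ^ (ν / 2))
      Filter.atTop (nhds ((1 + M * (1 - r)⁻¹) * √a)) := by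
    have h1 : Filter.Tendsto (fun k => t k ^ (ν / 2)) Filter.atTop (nhds 0) := by
      have := (tendsto_pow_atTop_nhds_zero_of_lt_one (r := (1 / 4 : ℝ)) (by norm_num)
        (by norm_num)).rpow_const (p := ν / 2) (Or.inr hα.le)
      rwa [zero_rpow hα.ne'] at this
    simpa using (h1.const_mul ‖E‖).const_add ((1 + M * (1 - r)⁻¹) * √a)
  -- The truncation error is at most ‖E‖ (t k)^(ν/2); it depends on ‖E‖ but vanishes in the limit,
  -- leaving a constant independent of E.
  refine ge_of_tendsto' hlim fun k => ?_
  have hcr : Continuous fun x : ℝ => x ^ (ν / 2) := continuous_id.rpow_const fun _ => Or.inr hα.le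
  have e : cfc (fun x : ℝ => x ^ (ν / 2)) R =
      cfc (f k) R - cfc (fun x => f k x - x ^ (ν / 2)) R := by
    rw [cfc_sub (f k) _ R (hf _).continuousOn hcr.continuousOn]
    abel
  rw [e, ContinuousLinearMap.comp_sub]
  refine (norm_sub_le _ _).trans (add_le_add ((hsum k).trans ?_) ?_)
  · rw [mul_comm]
    gcongr
    rw [← tsum_geometric_of_lt_one hr0 hr1]
    exact (summable_geometric_of_lt_one hr0 hr1).sum_le_tsum _ fun _ _ => by positivity
  · refine (ContinuousLinearMap.opNorm_comp_le _ _).trans ?_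
    gcongr
    exact norm_cfc_le (by positivity) fun x hx =>
      abs_mul_max_rpow_sub_le (ht k) hα (hs hx).1

variable (H) in
/-- If `‖E x‖² ≤ a ‖x‖ ‖A x‖` on the domain of the closure of `A`, then `E ⟨A⟩^{-ν}` is bounded by
a multiple of `√a` for every `ν > 1 / 2`. -/
theorem exists_norm_comp_japaneseNegPow_le {ν : ℝ} (hν : 1 / 2 < ν) :
    ∃ C : ℝ, 0 ≤ C ∧ ∀ (A : H →ₗ.[ℂ] H) (E : H →L[ℂ] H) (a : ℝ), 0 ≤ a →
      (∀ w ∈ closedGraph A, ‖E w.fst‖ ^ 2 ≤ a * (‖w.fst‖ * ‖w.snd‖)) →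
        ‖E ∘L japaneseNegPow A ν‖ ≤ C * √a := by
  obtain ⟨C, hC0, hC⟩ := exists_norm_comp_cfc_rpow_le H hν
  refine ⟨C, hC0, fun A E a ha hE => hC _ E (resolventSq_isPositive A).isSelfAdjoint
    (spectrum_resolventSq_subset A) a ha fun v => ?_⟩
  rw [resolventSq_eq_fst A v]
  refine (hE _ (Submodule.starProjection_apply_mem _ _)).trans ?_
  rw [← resolventSq_eq_fst]
  gcongr
  exact norm_snd_starProjection_le A v

end Interpolation



/-! ### Fourier multipliers identified by their symbols -/

section Multiplier

variable {s : ℕ}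

/-- `B` acts on `L²(ℝˢ)` as the Fourier multiplier with symbol `g`. -/
def IsMultiplier (B : L2 s →L[ℂ] L2 s) (g : EuclideanSpace ℝ (Fin s) → ℂ) : Prop :=
  ∀ f : L2 s, Lp.fourierTransformₗᵢ (EuclideanSpace ℝ (Fin s)) ℂ (B f) =ᵐ[volume]
    fun ξ => g ((2 * π) • ξ) * Lp.fourierTransformₗᵢ (EuclideanSpace ℝ (Fin s)) ℂ f ξ

theorem isMultiplier_fourierMul {g : EuclideanSpace ℝ (Fin s) → ℂ} (hg : Measurable g)
    (hb : ∃ C : ℝ, ∀ q, ‖g q‖ ≤ C) : IsMultiplier (fourierMul g hg hb) g := by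
  intro f
  set Φ := Lp.fourierTransformₗᵢ (EuclideanSpace ℝ (Fin s)) ℂ with hΦ
  have e : Φ (fourierMul g hg hb f) = (ContinuousLinearMap.mul ℂ ℂ).holderL volume ∞ 2 2
      ((memLp_dilated hg hb).toLp _) (Φ f) := Φ.apply_symm_apply _
  rw [e, ContinuousLinearMap.holderL_apply_apply]
  filter_upwards [(ContinuousLinearMap.mul ℂ ℂ).coeFn_holder (r := 2)
    ((memLp_dilated hg hb).toLp _) (Φ f), (memLp_dilated hg hb).coeFn_toLp] with ξ h1 h2
  rw [h1, h2]
  rfl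

theorem isMultiplier_energyCalculus (m : ℝ) (p : EuclideanSpace ℝ (Fin s)) {φ : ℝ → ℂ}
    (hφ : Measurable φ) (hb : ∃ C : ℝ, ∀ x, ‖φ x‖ ≤ C) :
    IsMultiplier (energyCalculus m p φ hφ hb) fun q => φ (omegaP m p q) :=
  isMultiplier_fourierMul _ _

namespace IsMultiplier

variable {B B' : L2 s →L[ℂ] L2 s} {g g' : EuclideanSpace ℝ (Fin s) → ℂ}

theorem sub (h : IsMultiplier B g) (h' : IsMultiplier B' g') :
    IsMultiplier (B - B') fun q => g q - g' q := by
  intro f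
  rw [sub_apply, map_sub]
  filter_upwards [h f, h' f, Lp.coeFn_sub (Lp.fourierTransformₗᵢ _ ℂ (B f))
    (Lp.fourierTransformₗᵢ _ ℂ (B' f))] with ξ h1 h2 h3
  rw [h3, Pi.sub_apply, h1, h2, sub_mul]

theorem add (h : IsMultiplier B g) (h' : IsMultiplier B' g') :
    IsMultiplier (B + B') fun q => g q + g' q := by
  intro f
  rw [add_apply, map_add]
  filter_upwards [h f, h' f, Lp.coeFn_add (Lp.fourierTransformₗᵢ _ ℂ (B f))
    (Lp.fourierTransformₗᵢ _ ℂ (B' f))] with ξ h1 h2 h3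
  rw [h3, Pi.add_apply, h1, h2, add_mul]

theorem smul (c : ℂ) (h : IsMultiplier B g) : IsMultiplier (c • B) fun q => c * g q := by
  intro f
  rw [smul_apply, map_smul]
  filter_upwards [h f, Lp.coeFn_smul c (Lp.fourierTransformₗᵢ _ ℂ (B f))] with ξ h1 h2
  rw [h2, Pi.smul_apply, h1, smul_eq_mul, mul_assoc]

theorem comp (h : IsMultiplier B g) (h' : IsMultiplier B' g') :
    IsMultiplier (B ∘L B') fun q => g q * g' q := by
  intro f
  filter_upwards [h (B' f), h' f] with ξ h1 h2
  rw [ContinuousLinearMap.comp_apply, h1, h2, mul_assoc]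

theorem zero : IsMultiplier (0 : L2 s →L[ℂ] L2 s) fun _ => 0 := by
  intro f
  rw [zero_apply, map_zero]
  filter_upwards [Lp.coeFn_zero ℂ 2 (volume : Measure (EuclideanSpace ℝ (Fin s)))] with ξ h1
  rw [h1, Pi.zero_apply, zero_mul]

theorem sum {ι : Type*} (t : Finset ι) {B : ι → L2 s →L[ℂ] L2 s}
    {g : ι → EuclideanSpace ℝ (Fin s) → ℂ} (h : ∀ i, IsMultiplier (B i) (g i)) :
    IsMultiplier (∑ i ∈ t, B i) fun q => ∑ i ∈ t, g i q := by
  classical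
  induction t using Finset.induction_on with
  | empty => simpa using zero
  | insert a t ha ih =>
    simp only [Finset.sum_insert ha]
    exact (h a).add ih

theorem ext (h : IsMultiplier B g) (h' : IsMultiplier B' g) : B = B' := by
  ext1 f
  apply (Lp.fourierTransformₗᵢ (EuclideanSpace ℝ (Fin s)) ℂ).injective
  apply Lp.ext
  filter_upwards [h f, h' f] with ξ h1 h2
  rw [h1, h2]

theorem norm_le (h : IsMultiplier B g) {c : ℝ} (hc : 0 ≤ c) (hg : ∀ q, ‖g q‖ ≤ c) :
    ‖B‖ ≤ c := by
  refine ContinuousLinearMap.opNorm_le_bound _ hc fun f => ?_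
  rw [← (Lp.fourierTransformₗᵢ (EuclideanSpace ℝ (Fin s)) ℂ).norm_map (B f),
    ← (Lp.fourierTransformₗᵢ (EuclideanSpace ℝ (Fin s)) ℂ).norm_map f]
  apply Lp.norm_le_mul_norm_of_ae_le_mul
  filter_upwards [h f] with ξ h1
  rw [h1, norm_mul]
  gcongr
  exact hg _

/-- Plancherel. For a real symbol the two hypotheses coincide when B = B', which yields symmetry. -/
theorem inner_left (h : IsMultiplier B fun q => (starRingEnd ℂ) (g q)) (h' : IsMultiplier B' g)
    (f f' : L2 s) : ⟪B f, f'⟫_ℂ = ⟪f, B' f'⟫_ℂ := by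
  rw [← (Lp.fourierTransformₗᵢ (EuclideanSpace ℝ (Fin s)) ℂ).inner_map_map (B f),
    ← (Lp.fourierTransformₗᵢ (EuclideanSpace ℝ (Fin s)) ℂ).inner_map_map f,
    L2.inner_def, L2.inner_def]
  apply integral_congr_ae
  filter_upwards [h f, h' f'] with ξ h1 h2
  rw [h1, h2]
  simp only [RCLike.inner_apply, map_mul, RingHomCompTriple.comp_apply, RingHom.id_apply]
  ring

end IsMultiplier

theorem isMultiplier_energyProj (m : ℝ) (p : EuclideanSpace ℝ (Fin s)) {J : Set ℝ}
    (hJ : MeasurableSet J) :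
    IsMultiplier (energyProj m p J hJ) fun q => J.indicator 1 (omegaP m p q) :=
  isMultiplier_energyCalculus _ _ _ _

theorem energyProj_comp_self (m : ℝ) (p : EuclideanSpace ℝ (Fin s)) {J : Set ℝ}
    (hJ : MeasurableSet J) :
    energyProj m p J hJ ∘L energyProj m p J hJ = energyProj m p J hJ := by
  refine ((isMultiplier_energyProj m p hJ).comp (isMultiplier_energyProj m p hJ)).ext ?_
  convert isMultiplier_energyProj m p hJ using 2 with q
  by_cases h : omegaP m p q ∈ J <;> simp [h]

theorem isSelfAdjoint_energyProj (m : ℝ) (p : EuclideanSpace ℝ (Fin s)) {J : Set ℝ}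
    (hJ : MeasurableSet J) : IsSelfAdjoint (energyProj m p J hJ) := by
  rw [ContinuousLinearMap.isSelfAdjoint_iff_isSymmetric]
  refine IsMultiplier.inner_left ?_ (isMultiplier_energyProj m p hJ)
  convert isMultiplier_energyProj m p hJ using 2 with q
  by_cases h : omegaP m p q ∈ J <;> simp [h]

theorem norm_energyProj_sq (m : ℝ) (p : EuclideanSpace ℝ (Fin s)) {J : Set ℝ}
    (hJ : MeasurableSet J) (f : L2 s) :
    ‖energyProj m p J hJ f‖ ^ 2 = (⟪energyProj m p J hJ f, f⟫_ℂ).re := by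
  have h := (ContinuousLinearMap.isSelfAdjoint_iff_isSymmetric.1
    (isSelfAdjoint_energyProj m p hJ)) (energyProj m p J hJ f) f
  have e : energyProj m p J hJ (energyProj m p J hJ f) = energyProj m p J hJ f :=
    DFunLike.congr_fun (energyProj_comp_self m p hJ) f
  simp only [ContinuousLinearMap.coe_coe, e] at h
  rw [h]
  exact (inner_self_eq_norm_sq (𝕜 := ℂ) (energyProj m p J hJ f)).symm

end Multiplier



/-! ### Commutators of the dilation operator with Fourier multipliers -/

section Commutator

open LineDeriv

variable {s : ℕ}

/-- Links the Schwartz-space multipliers, whose symbols are functions of the frequency ξ, to bounded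
operators on L², whose symbols are functions of q = 2πξ. -/
theorem toLp_fourierMultiplierCLM {B : L2 s →L[ℂ] L2 s} {g G : EuclideanSpace ℝ (Fin s) → ℂ}
    (hB : IsMultiplier B g) (hG : G.HasTemperateGrowth) (h : ∀ ξ, G ξ = g ((2 * π) • ξ))
    (f : 𝓢(EuclideanSpace ℝ (Fin s), ℂ)) :
    (SchwartzMap.fourierMultiplierCLM ℂ G f).toLp 2 volume = B (f.toLp 2 volume) := by
  apply (Lp.fourierTransformₗᵢ (EuclideanSpace ℝ (Fin s)) ℂ).injective
  have h1 (f : 𝓢(EuclideanSpace ℝ (Fin s), ℂ)) :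
      Lp.fourierTransformₗᵢ (EuclideanSpace ℝ (Fin s)) ℂ (f.toLp 2 volume) =
        (𝓕 f).toLp 2 volume := SchwartzMap.toLp_fourier_eq f
  apply Lp.ext
  have h2 := hB (f.toLp 2 volume)
  rw [h1] at h2 ⊢
  rw [SchwartzMap.fourierMultiplierCLM_apply, FourierTransform.fourier_fourierInv_eq]
  filter_upwards [h2, (𝓕 f).coeFn_toLp 2 volume,
    (SchwartzMap.smulLeftCLM ℂ G (𝓕 f)).coeFn_toLp 2 volume] with ξ h3 h4 h5
  rw [h3, h4, h5, SchwartzMap.smulLeftCLM_apply_apply hG, h, smul_eq_mul]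

theorem coord_hasTemperateGrowth (j : Fin s) :
    Function.HasTemperateGrowth fun u : EuclideanSpace ℝ (Fin s) => ((u j : ℝ) : ℂ) :=
  (Complex.ofRealCLM ∘L (EuclideanSpace.proj j : EuclideanSpace ℝ (Fin s) →L[ℝ] ℝ)
    ).hasTemperateGrowth

theorem fourier_coordMul (j : Fin s) (f : 𝓢(EuclideanSpace ℝ (Fin s), ℂ)) :
    𝓕 (coordMul j f) =
      (Complex.I / (2 * π)) • ∂_{EuclideanSpace.single j (1 : ℝ)} (𝓕 f) := by
  have hj : Function.HasTemperateGrowth fun u : EuclideanSpace ℝ (Fin s) =>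
      inner ℝ u (EuclideanSpace.single j (1 : ℝ)) :=
    ((innerSL ℝ).flip (EuclideanSpace.single j (1 : ℝ))).hasTemperateGrowth
  rw [SchwartzMap.lineDerivOp_fourier_eq, ← FourierTransform.fourier_smul, smul_smul]
  congr 1
  ext u
  simp only [coordMul, smul_apply]
  rw [SchwartzMap.smulLeftCLM_apply_apply (coord_hasTemperateGrowth j),
    SchwartzMap.smulLeftCLM_apply_apply hj]
  have hπ : (π : ℂ) ≠ 0 := by exact_mod_cast pi_ne_zero
  have e : Complex.I / (2 * π) * -(2 * π * Complex.I) = 1 := by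
    field_simp
    simp
  rw [e, one_smul, EuclideanSpace.inner_single_right]
  simp

/-- On the Fourier side u_j is (i/2π)∂_j, so this is the Leibniz rule. -/
theorem coordMul_fourierMultiplierCLM (j : Fin s) (g f : 𝓢(EuclideanSpace ℝ (Fin s), ℂ)) :
    coordMul j (SchwartzMap.fourierMultiplierCLM ℂ g f) =
      SchwartzMap.fourierMultiplierCLM ℂ g (coordMul j f) + (Complex.I / (2 * π)) •
        SchwartzMap.fourierMultiplierCLM ℂ 
          (∂_{EuclideanSpace.single j (1 : ℝ)} g : 𝓢(EuclideanSpace ℝ (Fin s), ℂ)) f := by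
  have hinj : Function.Injective (fun f : 𝓢(EuclideanSpace ℝ (Fin s), ℂ) => 𝓕 f) :=
    Function.LeftInverse.injective (g := fun f => 𝓕⁻ f)
      FourierTransform.fourierInv_fourier_eq
  apply hinj
  simp only [FourierTransform.fourier_add, FourierTransform.fourier_smul]
  rw [fourier_coordMul]
  simp only [SchwartzMap.fourierMultiplierCLM_apply, FourierTransform.fourier_fourierInv_eq]
  rw [fourier_coordMul]
  ext ξ
  have hg := g.hasTemperateGrowth
  have hg' := (∂_{EuclideanSpace.single j (1 : ℝ)} g :
    𝓢(EuclideanSpace ℝ (Fin s), ℂ)).hasTemperateGrowth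
  simp only [add_apply, smul_apply,
    SchwartzMap.smulLeftCLM_apply_apply hg, SchwartzMap.smulLeftCLM_apply_apply hg',
    SchwartzMap.lineDerivOp_apply_eq_fderiv, smul_eq_mul]
  rw [SchwartzMap.smulLeftCLM_apply hg]
  have h := (g.hasFDerivAt (x := ξ)).mul ((𝓕 f).hasFDerivAt (x := ξ))
  have e : fderiv ℝ (fun x => g x • (𝓕 f) x) ξ = _ := h.fderiv
  rw [e]
  simp
  ring

theorem inner_coordMul (j : Fin s) (f g : 𝓢(EuclideanSpace ℝ (Fin s), ℂ)) :
    ⟪(coordMul j f).toLp 2 volume, g.toLp 2 volume⟫_ℂ =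
      ⟪f.toLp 2 volume, (coordMul j g).toLp 2 volume⟫_ℂ := by
  rw [L2.inner_def, L2.inner_def]
  apply integral_congr_ae
  filter_upwards [f.coeFn_toLp 2 volume, g.coeFn_toLp 2 volume,
    (coordMul j f).coeFn_toLp 2 volume, (coordMul j g).coeFn_toLp 2 volume] with u h1 h2 h3 h4
  rw [h1, h2, h3, h4]
  simp only [coordMul, SchwartzMap.smulLeftCLM_apply_apply (coord_hasTemperateGrowth j),
    smul_eq_mul, RCLike.inner_apply, map_mul, Complex.conj_ofReal]
  ring

variable {m : ℝ} {θ : ℝ → ℝ}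

theorem contDiff_omegaP (hm : 0 < m) (p : EuclideanSpace ℝ (Fin s)) :
    ContDiff ℝ ∞ (omegaP m p) :=
  ((contDiff_omega hm).comp (contDiff_const.add contDiff_id)).add
    ((contDiff_omega hm).comp (contDiff_const.sub contDiff_id))

/-- This is the purpose of dividing by |∇ω_p|²: no trace of the size of the gradient remains, hence
no dependence on p in the estimates. At q = 0, where the gradient vanishes, θ vanishes as well
because its support lies in (0, ∞). -/
theorem inner_vectorField_gradient (hm : 0 < m) (hθs : tsupport θ ⊆ Ioi 0)
    (p q : EuclideanSpace ℝ (Fin s)) :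
    inner ℝ (vectorField m θ p q) (∇ (omegaP m p) q) =
      θ (omegaP m p q - 2 * omega m ((1 / 2 : ℝ) • p)) := by
  by_cases hq : q = 0
  · have h0 : θ (omegaP m p q - 2 * omega m ((1 / 2 : ℝ) • p)) = 0 := by
      apply image_eq_zero_of_notMem_tsupport
      intro h
      have := hθs h
      simp [hq, omegaP, two_mul] at this
    rw [vectorField, h0, zero_div, zero_smul, inner_zero_left]
  · have hne : ‖∇ (omegaP m p) q‖ ≠ 0 := norm_ne_zero_iff.2 (gradient_omegaP_ne_zero hm p hq)
    rw [vectorField, real_inner_smul_left, real_inner_self_eq_norm_sq,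
      div_mul_cancel₀ _ (pow_ne_zero 2 hne)]

/-- The components of the vector field as bounded operators on `L²(ℝˢ)`. -/
theorem exists_isMultiplier_vectorField (hm : 0 < m) (hθ : ContDiff ℝ ∞ θ)
    (hθc : HasCompactSupport θ) (hθs : tsupport θ ⊆ Ioi 0) (p : EuclideanSpace ℝ (Fin s))
    (j : Fin s) : ∃ B : L2 s →L[ℂ] L2 s,
      IsMultiplier B fun q => ((vectorField m θ p q j : ℝ) : ℂ) := by
  have hc : Continuous fun q => ((vectorField m θ p q j : ℝ) : ℂ) :=
    Complex.continuous_ofReal.comp ((EuclideanSpace.proj j :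
      EuclideanSpace ℝ (Fin s) →L[ℝ] ℝ).continuous.comp (contDiff_vectorField hm hθ hθs p).continuous)
  have h1 : HasCompactSupport fun q => ((vectorField m θ p q j : ℝ) : ℂ) :=
    (hasCompactSupport_vectorField m hθc p).comp_left
      (g := fun v : EuclideanSpace ℝ (Fin s) => ((v j : ℝ) : ℂ)) (by simp)
  exact ⟨_, isMultiplier_fourierMul hc.measurable (hc.bounded_above_of_compact_support h1)⟩

theorem exists_isMultiplier_schwartz (g : 𝓢(EuclideanSpace ℝ (Fin s), ℂ)) :
    ∃ B : L2 s →L[ℂ] L2 s, IsMultiplier B fun q => g ((2 * π)⁻¹ • q) := by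
  obtain ⟨C, -, hC⟩ := g.decay 0 0
  exact ⟨_, isMultiplier_fourierMul (g.continuous.comp (continuous_const_smul _)).measurable
    ⟨C, fun q => by simpa using hC ((2 * π)⁻¹ • q)⟩⟩

/-- F_j(D) and u_j are symmetric, and passing to the adjoint swaps the two orderings in the
symmetrised product. -/
theorem inner_dilationSchwartz (hm : 0 < m) (hθ : ContDiff ℝ ∞ θ)
    (hθc : HasCompactSupport θ) (hθs : tsupport θ ⊆ Ioi 0) (p : EuclideanSpace ℝ (Fin s))
    (f g : 𝓢(EuclideanSpace ℝ (Fin s), ℂ)) :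
    ⟪(dilationSchwartz m θ p f).toLp 2 volume, g.toLp 2 volume⟫_ℂ =
      ⟪f.toLp 2 volume, (dilationSchwartz m θ p g).toLp 2 volume⟫_ℂ := by
  have hF (j : Fin s) (f g : 𝓢(EuclideanSpace ℝ (Fin s), ℂ)) :
      ⟪(vectorFieldMul m θ p j f).toLp 2 volume, g.toLp 2 volume⟫_ℂ =
        ⟪f.toLp 2 volume, (vectorFieldMul m θ p j g).toLp 2 volume⟫_ℂ := by
    obtain ⟨B, hB⟩ := exists_isMultiplier_vectorField hm hθ hθc hθs p j
    have h := vectorFieldMul_hasTemperateGrowth hm hθ hθc hθs p j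
    rw [vectorFieldMul, toLp_fourierMultiplierCLM hB h fun _ => rfl,
      toLp_fourierMultiplierCLM hB h fun _ => rfl]
    exact IsMultiplier.inner_left (by simpa using hB) hB _ _
  have e (f : 𝓢(EuclideanSpace ℝ (Fin s), ℂ)) :
      (dilationSchwartz m θ p f).toLp 2 volume = (1 / 2 : ℂ) • ∑ j : Fin s,
        ((vectorFieldMul m θ p j (coordMul j f)).toLp 2 volume +
          (coordMul j (vectorFieldMul m θ p j f)).toLp 2 volume) := by
    simp only [← SchwartzMap.toLpCLM_apply (𝕜 := ℂ), ← map_add, ← map_sum, ← map_smul]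
    simp [dilationSchwartz]
  rw [e f, e g, inner_smul_left, inner_smul_right, sum_inner, inner_sum]
  congr 1
  · simp [map_ofNat (starRingEnd ℂ) 2]
  · refine Finset.sum_congr rfl fun j _ => ?_
    rw [inner_add_left, inner_add_right, hF, inner_coordMul, inner_coordMul, hF, add_comm]

/-- F_j(D) commutes with g(D), so only u_j contributes; the two orderings give the same term, which
cancels the factor 1/2. -/
theorem dilationSchwartz_fourierMultiplierCLM (hm : 0 < m) (hθ : ContDiff ℝ ∞ θ)
    (hθc : HasCompactSupport θ) (hθs : tsupport θ ⊆ Ioi 0) (p : EuclideanSpace ℝ (Fin s))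
    (g f : 𝓢(EuclideanSpace ℝ (Fin s), ℂ)) :
    dilationSchwartz m θ p (SchwartzMap.fourierMultiplierCLM ℂ g f) -
        SchwartzMap.fourierMultiplierCLM ℂ g (dilationSchwartz m θ p f) =
      (Complex.I / (2 * π)) • ∑ j : Fin s, vectorFieldMul m θ p j
        (SchwartzMap.fourierMultiplierCLM ℂ 
          (∂_{EuclideanSpace.single j (1 : ℝ)} g : 𝓢(EuclideanSpace ℝ (Fin s), ℂ)) f) := by
  have hcomm (j : Fin s) (g f : 𝓢(EuclideanSpace ℝ (Fin s), ℂ)) :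
      vectorFieldMul m θ p j (SchwartzMap.fourierMultiplierCLM ℂ g f) =
        SchwartzMap.fourierMultiplierCLM ℂ g (vectorFieldMul m θ p j f) := by
    have h := vectorFieldMul_hasTemperateGrowth hm hθ hθc hθs p j
    rw [vectorFieldMul, SchwartzMap.fourierMultiplierCLM_fourierMultiplierCLM_apply h
      g.hasTemperateGrowth, SchwartzMap.fourierMultiplierCLM_fourierMultiplierCLM_apply
      g.hasTemperateGrowth h, mul_comm]
  simp only [dilationSchwartz, smul_apply, sum_apply, add_apply,
    ContinuousLinearMap.comp_apply, map_smul, map_sum, map_add]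
  rw [← smul_sub, ← Finset.sum_sub_distrib, Finset.smul_sum, Finset.smul_sum]
  refine Finset.sum_congr rfl fun j _ => ?_
  rw [coordMul_fourierMultiplierCLM, hcomm j g f, coordMul_fourierMultiplierCLM, map_add,
    map_smul, hcomm j g, ← hcomm j 
          (∂_{EuclideanSpace.single j (1 : ℝ)} g : 𝓢(EuclideanSpace ℝ (Fin s), ℂ)) f]
  module

end Commutator



/-! ### Positive commutator estimate on short energy intervals -/

section CommutatorEstimate

open LineDeriv

variable {s : ℕ}

theorem IsMultiplier.re_inner_nonneg {B : L2 s →L[ℂ] L2 s} {r : EuclideanSpace ℝ (Fin s) → ℝ}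
    (h : IsMultiplier B fun q => (r q : ℂ)) (hr : ∀ q, 0 ≤ r q) (f : L2 s) :
    0 ≤ (⟪B f, f⟫_ℂ).re := by
  set Φ := Lp.fourierTransformₗᵢ (EuclideanSpace ℝ (Fin s)) ℂ with hΦ
  have e : ⟪B f, f⟫_ℂ = ∫ ξ, ((r ((2 * π) • ξ) * ‖Φ f ξ‖ ^ 2 : ℝ) : ℂ) := by
    rw [← Φ.inner_map_map, L2.inner_def]
    apply integral_congr_ae
    filter_upwards [h f] with ξ h1
    rw [h1, RCLike.inner_apply, map_mul, Complex.conj_ofReal, mul_left_comm, Complex.mul_conj,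
      Complex.normSq_eq_norm_sq, Complex.ofReal_mul]
  rw [e, integral_complex_ofReal, Complex.ofReal_re]
  exact integral_nonneg fun ξ => mul_nonneg (hr _) (sq_nonneg _)

/-- A compactly supported function has a primitive vanishing to the right of the support and
bounded by the integral of its absolute value. -/
theorem exists_primitive {η : ℝ → ℝ} (hη : ContDiff ℝ ∞ η) {M a r : ℝ} (hr : 0 ≤ r)
    (hM : ∀ x, |η x| ≤ M) (hs : ∀ x ∉ Metric.closedBall a r, η x = 0) :
    ∃ ψ : ℝ → ℝ, ContDiff ℝ ∞ ψ ∧ (∀ x, HasDerivAt ψ (η x) x) ∧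
      (∀ x, a + r ≤ x → ψ x = 0) ∧ ∀ x, |ψ x| ≤ M * (2 * r) := by
  have hd (x : ℝ) : HasDerivAt (fun x => ∫ y in (a + r)..x, η y) (η x) x :=
    (hη.continuous.integral_hasStrictDerivAt _ _).hasDerivAt
  refine ⟨fun x => ∫ y in (a + r)..x, η y, ?_, hd, fun x hx => ?_, fun x => ?_⟩
  · rw [contDiff_infty_iff_deriv]
    refine ⟨fun x => (hd x).differentiableAt, ?_⟩
    rwa [funext fun x => (hd x).deriv]
  · have e : ∀ y ∈ Ioc (a + r) x, η y = 0 := fun y hy => hs y fun h => by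
      rw [Metric.mem_closedBall, dist_eq, abs_le] at h
      linarith [hy.1, h.2]
    beta_reduce
    rw [intervalIntegral.integral_of_le hx]
    exact setIntegral_eq_zero_of_forall_eq_zero e
  · have hint : Integrable fun y => ‖η y‖ :=
      (hη.continuous.integrable_of_hasCompactSupport
        (HasCompactSupport.intro (isCompact_closedBall a r) fun x hx => hs x hx)).norm
    change ‖∫ y in (a + r)..x, η y‖ ≤ _
    calc ‖∫ y in (a + r)..x, η y‖ ≤ ∫ y in uIoc (a + r) x, ‖η y‖ :=
          intervalIntegral.norm_integral_le_integral_norm_uIoc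
      _ ≤ ∫ y, ‖η y‖ :=
          setIntegral_le_integral hint (Filter.Eventually.of_forall fun _ => norm_nonneg _)
      _ = ∫ y in Metric.closedBall a r, ‖η y‖ := by
          rw [setIntegral_eq_integral_of_forall_compl_eq_zero]
          exact fun x hx => by rw [hs x hx, norm_zero]
      _ ≤ ‖∫ y in Metric.closedBall a r, ‖η y‖‖ := le_abs_self _
      _ ≤ M * volume.real (Metric.closedBall a r) :=
          norm_setIntegral_le_of_norm_le_const measure_closedBall_lt_top fun y _ => by
            simpa using hM y
      _ = M * (2 * r) := by rw [Real.volume_real_closedBall hr]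

variable {m : ℝ} {θ : ℝ → ℝ}

/-- The commutator estimate `|⟨x, i[A, ψ(ω_p(D))] x⟩| ≤ 2 ‖ψ‖_∞ ‖x‖ ‖A x‖` on the Schwartz space,
where `i[A, ψ(ω_p(D))]` dominates a spectral projection. -/
theorem norm_energyProj_toLp_sq_le (hm : 0 < m) (hθ : ContDiff ℝ ∞ θ)
    (hθc : HasCompactSupport θ) (hθs : tsupport θ ⊆ Ioi 0) (p : EuclideanSpace ℝ (Fin s))
    {η ψ : ℝ → ℝ} {R b : ℝ} (hψ : ContDiff ℝ ∞ ψ) (hd : ∀ x, HasDerivAt ψ (η x) x)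
    (hR : ∀ x, R ≤ x → ψ x = 0) (hb : ∀ x, |ψ x| ≤ b) {J : Set ℝ} (hJ : MeasurableSet J)
    (hηJ : ∀ x, J.indicator 1 x ≤ η x * θ (x - 2 * omega m ((1 / 2 : ℝ) • p)))
    (f : 𝓢(EuclideanSpace ℝ (Fin s), ℂ)) :
    ‖energyProj m p J hJ (f.toLp 2 volume)‖ ^ 2 ≤ 2 * b *
      (‖f.toLp 2 volume‖ * ‖(dilationSchwartz m θ p f).toLp 2 volume‖) := by
  have hb0 : 0 ≤ b := (abs_nonneg _).trans (hb 0)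
  have hψω : ContDiff ℝ ∞ fun q : EuclideanSpace ℝ (Fin s) => ((ψ (omegaP m p q) : ℝ) : ℂ) :=
    Complex.ofRealCLM.contDiff.comp (hψ.comp (contDiff_omegaP hm p))
  -- Since ω_p(q) ≥ |q|, vanishing of ψ on the right suffices for compact support of ψ ∘ ω_p; its
  -- values far to the left do not matter. Thus ψ(H) preserves the Schwartz space.
  have hsupp : HasCompactSupport
      fun q : EuclideanSpace ℝ (Fin s) => ((ψ (omegaP m p q) : ℝ) : ℂ) := by
    refine HasCompactSupport.intro (isCompact_closedBall (0 : EuclideanSpace ℝ (Fin s)) R)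
      fun q hq => ?_
    simp only [Metric.mem_closedBall, dist_zero_right, not_le] at hq
    rw [hR _ (hq.le.trans (norm_le_omegaP m p q)), Complex.ofReal_zero]
  have hsupp' : HasCompactSupport fun ξ : EuclideanSpace ℝ (Fin s) =>
      ((ψ (omegaP m p ((2 * π) • ξ)) : ℝ) : ℂ) :=
    hsupp.comp_homeomorph (Homeomorph.smulOfNeZero (2 * π) (by positivity))
  let g : 𝓢(EuclideanSpace ℝ (Fin s), ℂ) :=
    hsupp'.toSchwartzMap (hψω.comp (contDiff_const_smul (2 * π)))
  have hg (ξ : EuclideanSpace ℝ (Fin s)) : g ξ = ((ψ (omegaP m p ((2 * π) • ξ)) : ℝ) : ℂ) := rfl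
  have hBg := isMultiplier_fourierMul hψω.continuous.measurable
    (hψω.continuous.bounded_above_of_compact_support hsupp)
  set Bg := fourierMul _ hψω.continuous.measurable
    (hψω.continuous.bounded_above_of_compact_support hsupp)
  have hBg_norm : ‖Bg‖ ≤ b := hBg.norm_le hb0 fun q => by
    rw [Complex.norm_real]
    exact hb _
  choose BF hBF using fun j => exists_isMultiplier_vectorField hm hθ hθc hθs p j
  choose BD hBD using fun j : Fin s => exists_isMultiplier_schwartz
    (∂_{EuclideanSpace.single j (1 : ℝ)} g : 𝓢(EuclideanSpace ℝ (Fin s), ℂ))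
  -- Chain rule: F_p·∇(ψ ∘ ω_p) = η(ω_p) F_p·∇ω_p. The factor 2π comes from differentiating in ξ
  -- rather than in q.
  have hsymb (q : EuclideanSpace ℝ (Fin s)) :
      ∑ j : Fin s, ((vectorField m θ p q j : ℝ) : ℂ) *
        (∂_{EuclideanSpace.single j (1 : ℝ)} g : 𝓢(EuclideanSpace ℝ (Fin s), ℂ))
          ((2 * π)⁻¹ • q) =
      ((2 * π * (η (omegaP m p q) * θ (omegaP m p q - 2 * omega m ((1 / 2 : ℝ) • p))) : ℝ) :
        ℂ) := by
    have hq : (2 * π) • ((2 * π)⁻¹ • q) = q := smul_inv_smul₀ (by positivity) q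
    have h1 : HasFDerivAt (omegaP m p) (innerSL ℝ (∇ (omegaP m p) q))
        ((2 * π) • ((2 * π)⁻¹ • q)) := by
      rw [hq]
      exact (((contDiff_omegaP hm p).differentiable (by simp)) q).hasGradientAt.hasFDerivAt
    have h2 : HasFDerivAt g _ ((2 * π)⁻¹ • q) :=
      Complex.ofRealCLM.hasFDerivAt.comp _ ((hd _).comp_hasFDerivAt _
        (h1.comp _ ((hasFDerivAt_id ((2 * π)⁻¹ • q)).const_smul (2 * π))))
    rw [← inner_vectorField_gradient hm hθs, PiLp.inner_apply, Finset.mul_sum, Finset.mul_sum,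
      Complex.ofReal_sum]
    refine Finset.sum_congr rfl fun j _ => ?_
    rw [SchwartzMap.lineDerivOp_apply_eq_fderiv, h2.fderiv, hq]
    generalize ∇ (omegaP m p) q = G
    simp
    rw [EuclideanSpace.inner_single_right]
    simp
    ring
  let K : L2 s →L[ℂ] L2 s := (1 / (2 * π) : ℂ) • ∑ j : Fin s, BF j ∘L BD j
  have hK : IsMultiplier K fun q =>
      ((η (omegaP m p q) * θ (omegaP m p q - 2 * omega m ((1 / 2 : ℝ) • p)) : ℝ) : ℂ) := by
    have h := (IsMultiplier.sum Finset.univ fun j => (hBF j).comp (hBD j)).smul (1 / (2 * π) : ℂ)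
    simp only [hsymb] at h
    convert h using 2 with q
    have hπ : (π : ℂ) ≠ 0 := by exact_mod_cast pi_ne_zero
    push_cast
    field_simp
  set x := f.toLp 2 volume with hx
  set y := (dilationSchwartz m θ p f).toLp 2 volume with hy
  have hgx (f : 𝓢(EuclideanSpace ℝ (Fin s), ℂ)) :
      (SchwartzMap.fourierMultiplierCLM ℂ g f).toLp 2 volume = Bg (f.toLp 2 volume) :=
    toLp_fourierMultiplierCLM hBg g.hasTemperateGrowth hg f
  have hcomm : Complex.I • K x =
      (dilationSchwartz m θ p (SchwartzMap.fourierMultiplierCLM ℂ g f)).toLp 2 volume - Bg y := by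
    have h := congrArg (SchwartzMap.toLpCLM ℂ (E := EuclideanSpace ℝ (Fin s)) ℂ 2 volume)
      (dilationSchwartz_fourierMultiplierCLM hm hθ hθc hθs p g f)
    simp only [map_sub, map_smul, map_sum, SchwartzMap.toLpCLM_apply] at h
    rw [hy, ← hgx, h]
    simp only [K, smul_apply, sum_apply, smul_smul, ContinuousLinearMap.comp_apply]
    congr 1
    · ring
    refine Finset.sum_congr rfl fun j _ => ?_
    rw [vectorFieldMul, toLp_fourierMultiplierCLM (hBF j)
      (vectorFieldMul_hasTemperateGrowth hm hθ hθc hθs p j) fun _ => rfl,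
      toLp_fourierMultiplierCLM (hBD j) (SchwartzMap.hasTemperateGrowth _) fun ξ => by
        rw [inv_smul_smul₀ (by positivity)]]
  -- Symmetry moves the dilation operator onto x, giving ⟨ψ(H)x, y⟩ − ⟨ψ(H)y, x⟩ with y = Ax; no
  -- derivative of ψ enters the bound.
  have hKx : ‖⟪K x, x⟫_ℂ‖ ≤ 2 * b * (‖x‖ * ‖y‖) := by
    have e : ‖⟪K x, x⟫_ℂ‖ = ‖⟪Complex.I • K x, x⟫_ℂ‖ := by simp [inner_smul_left]
    rw [e, hcomm, inner_sub_left, hx, inner_dilationSchwartz hm hθ hθc hθs, hgx]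
    refine (norm_sub_le _ _).trans ?_
    have h1 := (norm_inner_le_norm (𝕜 := ℂ) (Bg x) y).trans
      (mul_le_mul_of_nonneg_right (Bg.le_of_opNorm_le hBg_norm x) (norm_nonneg y))
    have h2 := (norm_inner_le_norm (𝕜 := ℂ) (Bg y) x).trans
      (mul_le_mul_of_nonneg_right (Bg.le_of_opNorm_le hBg_norm y) (norm_nonneg x))
    rw [← hx, ← hy]
    linarith
  have hpos : 0 ≤ (⟪(K - energyProj m p J hJ) x, x⟫_ℂ).re := by
    refine IsMultiplier.re_inner_nonneg (r := fun q => η (omegaP m p q) *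
      θ (omegaP m p q - 2 * omega m ((1 / 2 : ℝ) • p)) - J.indicator 1 (omegaP m p q)) ?_
      (fun q => sub_nonneg.2 (hηJ _)) x
    convert hK.sub (isMultiplier_energyProj m p hJ) using 2 with q
    by_cases h : omegaP m p q ∈ J <;> simp [h]
  rw [sub_apply, inner_sub_left, Complex.sub_re, ← norm_energyProj_sq] at hpos
  linarith [Complex.re_le_norm ⟪K x, x⟫_ℂ]

/-- Take η = χθ (θ shifted) for a bump χ that is 1 within δ of a and 0 beyond 2δ. Then ηθ = χθ² is
nonnegative, even where θ is negative, and is 1 on J. The primitive of η is at most 4Mδ: this factor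
δ is the gain. -/
theorem norm_energyProj_fst_sq_le (hm : 0 < m) (hθ : ContDiff ℝ ∞ θ)
    (hθc : HasCompactSupport θ) (hθs : tsupport θ ⊆ Ioi 0) {M : ℝ} (hM : ∀ x, |θ x| ≤ M)
    (p : EuclideanSpace ℝ (Fin s)) {J : Set ℝ} (hJ : MeasurableSet J) {a δ : ℝ} (hδ : 0 < δ)
    (hJa : J ⊆ Metric.closedBall a δ)
    (hJθ : ∀ x ∈ J, θ (x - 2 * omega m ((1 / 2 : ℝ) • p)) = 1)
    {w : WithLp 2 (L2 s × L2 s)} (hw : w ∈ closedGraph (dilation m θ p)) :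
    ‖energyProj m p J hJ w.fst‖ ^ 2 ≤ 8 * M * δ * (‖w.fst‖ * ‖w.snd‖) := by
  have hM0 : 0 ≤ M := (abs_nonneg _).trans (hM 0)
  let χ : ContDiffBump a := ⟨δ, 2 * δ, hδ, by linarith⟩
  have hη : ContDiff ℝ ∞ fun x => χ x * θ (x - 2 * omega m ((1 / 2 : ℝ) • p)) :=
    χ.contDiff.mul (hθ.comp (contDiff_id.sub contDiff_const))
  obtain ⟨ψ, hψ, hd, hR, hb⟩ := exists_primitive hη (M := M) (a := a) (r := 2 * δ)
    (by positivity)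
    (fun x => by
      rw [abs_mul, abs_of_nonneg χ.nonneg]
      exact (mul_le_of_le_one_left (abs_nonneg _) χ.le_one).trans (hM _))
    (fun x hx => by
      rw [Metric.mem_closedBall, not_le] at hx
      rw [χ.zero_of_le_dist hx.le, zero_mul])
  have hηJ (x : ℝ) : J.indicator 1 x ≤ χ x * θ (x - 2 * omega m ((1 / 2 : ℝ) • p)) *
      θ (x - 2 * omega m ((1 / 2 : ℝ) • p)) := by
    by_cases hx : x ∈ J
    · rw [indicator_of_mem hx, hJθ x hx, χ.one_of_mem_closedBall (hJa hx)]
      simp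
    · rw [indicator_of_notMem hx, mul_assoc]
      exact mul_nonneg χ.nonneg (mul_self_nonneg _)
  have key := norm_energyProj_toLp_sq_le hm hθ hθc hθs p hψ hd hR hb hJ hηJ
  -- Both sides are continuous in the graph norm, so the inequality passes from Schwartz functions
  -- to the closed graph.
  have hclosed : IsClosed {w : WithLp 2 (L2 s × L2 s) |
      ‖energyProj m p J hJ w.fst‖ ^ 2 ≤ 8 * M * δ * (‖w.fst‖ * ‖w.snd‖)} := by
    have h1 : Continuous fun w : WithLp 2 (L2 s × L2 s) => w.fst :=
      (WithLp.fstL 2 ℂ (L2 s) (L2 s)).continuous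
    have h2 : Continuous fun w : WithLp 2 (L2 s × L2 s) => w.snd :=
      (WithLp.sndL 2 ℂ (L2 s) (L2 s)).continuous
    exact isClosed_le (((energyProj m p J hJ).continuous.comp h1).norm.pow 2)
      (continuous_const.mul (h1.norm.mul h2.norm))
  refine closure_minimal ?_ hclosed hw
  rintro _ ⟨v, hv, rfl⟩
  obtain ⟨⟨_, f, rfl⟩, h1, h2⟩ := (LinearPMap.mem_graph_iff _).1 hv
  have e := dilation_apply m θ p f ⟨f, rfl⟩
  have e1 : v.1 = f.toLp 2 volume := h1.symm
  have e2 : v.2 = (dilationSchwartz m θ p f).toLp 2 volume := h2.symm.trans e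
  have h3 := key f
  rw [← e1, ← e2] at h3
  refine h3.trans_eq ?_
  change 2 * (M * (2 * (2 * δ))) * (‖v.1‖ * ‖v.2‖) = 8 * M * δ * (‖v.1‖ * ‖v.2‖)
  ring

end CommutatorEstimate



/-! ### Kato smoothness by discretising the energy -/

section Kato

theorem integral_exp_orthogonal {δ : ℝ} (hδ : 0 < δ) (k l : ℕ) :
    ∫ τ in (-(π / δ))..(π / δ), Complex.exp (Complex.I * ((l : ℂ) - k) * δ * τ) =
      if k = l then ((2 * π / δ : ℝ) : ℂ) else 0 := by
  split_ifs with h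
  · subst h
    simp only [sub_self, mul_zero, zero_mul, Complex.exp_zero, intervalIntegral.integral_const]
    simp
    ring
  · have hδ' : (δ : ℂ) ≠ 0 := by exact_mod_cast hδ.ne'
    have hkl : (l : ℂ) - k ≠ 0 := sub_ne_zero.2 (by exact_mod_cast Ne.symm h)
    rw [integral_exp_mul_complex (mul_ne_zero (mul_ne_zero Complex.I_ne_zero hkl) hδ'),
      div_eq_zero_iff]
    left
    rw [sub_eq_zero, Complex.exp_eq_exp_iff_exists_int]
    -- Over a full period 2π/δ the exponent changes by 2πi(l − k), so the endpoint values agree.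
    refine ⟨(l : ℤ) - k, ?_⟩
    push_cast
    field_simp
    ring

/-- Parseval's identity on a period. -/
theorem lintegral_norm_sum_exp {H : Type*} [NormedAddCommGroup H] [InnerProductSpace ℂ H]
    {δ : ℝ} (hδ : 0 < δ) (N : ℕ) (v : ℕ → H) :
    ∫⁻ τ : ℝ in Ioc (-(π / δ)) (π / δ),
        ‖∑ k ∈ Finset.range N, Complex.exp (Complex.I * τ * (k * δ)) • v k‖ₑ ^ 2 =
      ENNReal.ofReal (2 * π / δ * ∑ k ∈ Finset.range N, ‖v k‖ ^ 2) := by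
  set S : ℝ → H := fun τ => ∑ k ∈ Finset.range N, Complex.exp (Complex.I * τ * (k * δ)) • v k
    with hS
  have hSc : Continuous S := by fun_prop
  have e1 (τ : ℝ) : ‖S τ‖ₑ ^ 2 = ENNReal.ofReal (‖S τ‖ ^ 2) := by
    rw [ENNReal.ofReal_pow (norm_nonneg _), ofReal_norm]
  have hle : -(π / δ) ≤ π / δ := by
    have : 0 < π / δ := by positivity
    linarith
  have e2 (τ : ℝ) : ((‖S τ‖ ^ 2 : ℝ) : ℂ) = ∑ k ∈ Finset.range N, ∑ l ∈ Finset.range N,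
      Complex.exp (Complex.I * ((l : ℂ) - k) * δ * τ) * ⟪v k, v l⟫_ℂ := by
    have h := inner_self_eq_norm_sq_to_K (𝕜 := ℂ) (S τ)
    rw [Complex.ofReal_pow]
    refine h.symm.trans ?_
    simp only [hS, sum_inner, inner_sum, inner_smul_left, inner_smul_right]
    simp_rw [Finset.mul_sum]
    rw [Finset.sum_comm]
    refine Finset.sum_congr rfl fun k _ => ?_
    refine Finset.sum_congr rfl fun l _ => ?_
    rw [← mul_assoc, ← Complex.exp_conj, ← Complex.exp_add]
    congr 2
    simp only [map_mul, Complex.conj_I, Complex.conj_ofReal, Complex.conj_natCast]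
    ring
  change ∫⁻ τ : ℝ in Ioc (-(π / δ)) (π / δ), ‖S τ‖ₑ ^ 2 = _
  have hint : Integrable (fun τ => ‖S τ‖ ^ 2) (volume.restrict (Ioc (-(π / δ)) (π / δ))) :=
    Continuous.integrableOn_Ioc (by fun_prop)
  simp_rw [e1]
  rw [← ofReal_integral_eq_lintegral_ofReal
    (f := fun τ => ‖S τ‖ ^ 2) hint (Filter.Eventually.of_forall fun _ => by positivity),
    ← intervalIntegral.integral_of_le hle]
  congr 1
  apply Complex.ofReal_injective
  rw [← intervalIntegral.integral_ofReal]
  simp_rw [e2]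
  rw [intervalIntegral.integral_finsetSum fun k _ =>
    Continuous.intervalIntegrable (by fun_prop) _ _]
  rw [Complex.ofReal_mul, Complex.ofReal_sum, Finset.mul_sum]
  refine Finset.sum_congr rfl fun k hk => ?_
  rw [intervalIntegral.integral_finsetSum fun l _ =>
    Continuous.intervalIntegrable (by fun_prop) _ _]
  simp_rw [intervalIntegral.integral_mul_const, integral_exp_orthogonal hδ, ite_mul, zero_mul]
  rw [Finset.sum_ite_eq, if_pos hk, inner_self_eq_norm_sq_to_K]
  simp

variable {s : ℕ} (m : ℝ) (p : EuclideanSpace ℝ (Fin s)) {I : Set ℝ}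

/-- The part of `I` in the `k`-th cell of the grid of width `δ`. -/
def cell (I : Set ℝ) (δ : ℝ) (k : ℕ) : Set ℝ := I ∩ {x | ⌊x / δ⌋₊ = k}

theorem measurableSet_cell (hI : MeasurableSet I) (δ : ℝ) (k : ℕ) :
    MeasurableSet (cell I δ k) :=
  hI.inter ((Nat.measurable_floor.comp (measurable_id.div_const δ)) (measurableSet_singleton k))

/-- Each point of I lies in exactly one cell, and the + 1 in the range includes the cell containing
β. Arbitrary coefficients c serve both the stepped evolution and, with c = 1, the Bessel inequality
for the cells. -/
theorem sum_mul_indicator_cell {δ β : ℝ} (hδ : 0 < δ) (hIβ : I ⊆ Icc 0 β) (c : ℕ → ℂ) (x : ℝ) :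
    ∑ k ∈ Finset.range (⌊β / δ⌋₊ + 1), c k * (cell I δ k).indicator 1 x =
      I.indicator (fun x => c ⌊x / δ⌋₊) x := by
  classical
  by_cases hx : x ∈ I
  · have h (k : ℕ) : c k * (cell I δ k).indicator 1 x = if ⌊x / δ⌋₊ = k then c k else 0 := by
      by_cases hk : ⌊x / δ⌋₊ = k <;> simp [cell, hx, hk]
    simp_rw [h]
    rw [Finset.sum_ite_eq, if_pos, indicator_of_mem hx]
    rw [Finset.mem_range, Nat.lt_succ_iff]
    exact Nat.floor_le_floor (div_le_div_of_nonneg_right (hIβ hx).2 hδ.le)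
  · simp [cell, hx]

theorem cell_subset_closedBall {δ β : ℝ} (hδ : 0 < δ) (hIβ : I ⊆ Icc 0 β) (k : ℕ) :
    cell I δ k ⊆ Metric.closedBall (k * δ) δ := by
  rintro x ⟨hx, hk⟩
  have h0 : 0 ≤ x / δ := div_nonneg (hIβ hx).1 hδ.le
  obtain ⟨h1, h2⟩ := (Nat.floor_eq_iff h0).1 hk
  rw [le_div_iff₀ hδ] at h1
  rw [div_lt_iff₀ hδ] at h2
  rw [Metric.mem_closedBall, dist_eq, abs_le]
  constructor <;> nlinarith

theorem norm_exp_sub_exp_floor_le {δ x : ℝ} (hδ : 0 < δ) (hx : 0 ≤ x) (τ : ℝ) :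
    ‖Complex.exp (Complex.I * τ * x) - Complex.exp (Complex.I * τ * (⌊x / δ⌋₊ * δ))‖ ≤
      |τ| * δ := by
  set k := ⌊x / δ⌋₊ with hk
  have h0 : 0 ≤ x / δ := div_nonneg hx hδ.le
  obtain ⟨h1, h2⟩ := (Nat.floor_eq_iff h0).1 hk.symm
  rw [le_div_iff₀ hδ] at h1
  rw [div_lt_iff₀ hδ] at h2
  have e : Complex.exp (Complex.I * τ * x) - Complex.exp (Complex.I * τ * (k * δ)) =
      Complex.exp (Complex.I * (τ * (k * δ) : ℝ)) *
        (Complex.exp (Complex.I * (τ * (x - k * δ) : ℝ)) - 1) := by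
    rw [mul_sub, ← Complex.exp_add, mul_one]
    push_cast
    ring_nf
  rw [e, norm_mul, mul_comm Complex.I, Complex.norm_exp_ofReal_mul_I, one_mul]
  refine (Real.norm_exp_I_mul_ofReal_sub_one_le).trans ?_
  rw [norm_eq_abs, abs_mul]
  gcongr
  rw [abs_le]
  constructor <;> nlinarith

/-- The evolution with the energy rounded down to the grid of width `δ`. -/
noncomputable def steppedEvolution (hI : MeasurableSet I) (β δ τ : ℝ) : L2 s →L[ℂ] L2 s :=
  ∑ k ∈ Finset.range (⌊β / δ⌋₊ + 1), Complex.exp (Complex.I * τ * (k * δ)) •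
    energyProj m p (cell I δ k) (measurableSet_cell hI δ k)

theorem norm_evolution_sub_steppedEvolution_le (hI : MeasurableSet I) {δ β : ℝ} (hδ : 0 < δ)
    (hIβ : I ⊆ Icc 0 β) (τ : ℝ) :
    ‖energyGroup m p τ ∘L energyProj m p I hI - steppedEvolution m p hI β δ τ‖ ≤ |τ| * δ := by
  have h1 := (isMultiplier_energyCalculus m p (φ := fun x => Complex.exp (Complex.I * τ * x))
    (by fun_prop) ⟨1, fun x => by simp [Complex.norm_exp]⟩).comp (isMultiplier_energyProj m p hI)
  have h2 := IsMultiplier.sum (Finset.range (⌊β / δ⌋₊ + 1)) fun k =>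
    (isMultiplier_energyProj m p (measurableSet_cell hI δ k)).smul
      (Complex.exp (Complex.I * τ * (k * δ)))
  refine (h1.sub h2).norm_le (by positivity) fun q => ?_
  rw [sum_mul_indicator_cell hδ hIβ (fun k => Complex.exp (Complex.I * τ * (k * δ)))]
  by_cases hq : omegaP m p q ∈ I
  · simp only [indicator_of_mem hq, Pi.one_apply, mul_one]
    exact norm_exp_sub_exp_floor_le hδ (hIβ hq).1 τ
  · simp only [indicator_of_notMem hq, mul_zero, sub_zero, norm_zero]
    positivity

/-- Bessel's inequality: the sum is ⟨Σ E(cell) f, f⟩, and Σ E(cell) has the indicator of I as its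
symbol, so its norm is at most 1. -/
theorem sum_norm_energyProj_cell_sq_le (hI : MeasurableSet I) {δ β : ℝ} (hδ : 0 < δ)
    (hIβ : I ⊆ Icc 0 β) (f : L2 s) :
    ∑ k ∈ Finset.range (⌊β / δ⌋₊ + 1),
      ‖energyProj m p (cell I δ k) (measurableSet_cell hI δ k) f‖ ^ 2 ≤ ‖f‖ ^ 2 := by
  have h2 := IsMultiplier.sum (Finset.range (⌊β / δ⌋₊ + 1)) fun k =>
    (isMultiplier_energyProj m p (measurableSet_cell hI δ k)).smul 1
  have h3 := h2.norm_le zero_le_one fun q => by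
    rw [sum_mul_indicator_cell hδ hIβ fun _ => 1]
    by_cases hq : omegaP m p q ∈ I <;> simp [hq]
  simp_rw [norm_energyProj_sq]
  rw [← Complex.re_sum, ← sum_inner]
  refine (Complex.re_le_norm _).trans ((norm_inner_le_norm _ _).trans ?_)
  rw [sq]
  gcongr
  simpa [sum_apply] using ContinuousLinearMap.le_of_opNorm_le _ h3 f

/-- Parseval contributes 2π/δ and each cell C²δ, so δ drops out. Writing E = E² keeps a factor E f
in each term, and Bessel's inequality sums them. -/
theorem lintegral_norm_steppedEvolution_le (hI : MeasurableSet I) {δ β : ℝ} (hδ : 0 < δ)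
    (hIβ : I ⊆ Icc 0 β) (T : L2 s →L[ℂ] L2 s) {C : ℝ}
    (hT : ∀ k, ‖T ∘L energyProj m p (cell I δ k) (measurableSet_cell hI δ k)‖ ≤ C * √δ)
    (f : L2 s) :
    ∫⁻ τ : ℝ in Ioc (-(π / δ)) (π / δ), ‖T (steppedEvolution m p hI β δ τ f)‖ₑ ^ 2 ≤
      ENNReal.ofReal (2 * π * C ^ 2 * ‖f‖ ^ 2) := by
  have e (τ : ℝ) : T (steppedEvolution m p hI β δ τ f) =
      ∑ k ∈ Finset.range (⌊β / δ⌋₊ + 1), Complex.exp (Complex.I * τ * (k * δ)) •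
        T (energyProj m p (cell I δ k) (measurableSet_cell hI δ k) f) := by
    simp [steppedEvolution, sum_apply, map_sum]
  simp_rw [e]
  rw [lintegral_norm_sum_exp hδ (⌊β / δ⌋₊ + 1)
    fun k => T (energyProj m p (cell I δ k) (measurableSet_cell hI δ k) f)]
  apply ENNReal.ofReal_le_ofReal
  have h (k : ℕ) : ‖T (energyProj m p (cell I δ k) (measurableSet_cell hI δ k) f)‖ ^ 2 ≤
      C ^ 2 * δ * ‖energyProj m p (cell I δ k) (measurableSet_cell hI δ k) f‖ ^ 2 := by
    have h1 := ContinuousLinearMap.le_of_opNorm_le _ (hT k)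
      (energyProj m p (cell I δ k) (measurableSet_cell hI δ k) f)
    rw [ContinuousLinearMap.comp_apply, ← ContinuousLinearMap.comp_apply (energyProj _ _ _ _),
      energyProj_comp_self] at h1
    calc _ ≤ (C * √δ * ‖energyProj m p (cell I δ k) (measurableSet_cell hI δ k) f‖) ^ 2 := by
          gcongr
      _ = _ := by rw [mul_pow, mul_pow, sq_sqrt hδ.le]
  calc _ ≤ 2 * π / δ * (C ^ 2 * δ * ‖f‖ ^ 2) := by
        gcongr
        refine (Finset.sum_le_sum fun k _ => h k).trans ?_
        rw [← Finset.mul_sum]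
        gcongr
        exact sum_norm_energyProj_cell_sq_le m p hI hδ hIβ f
    _ = _ := by field_simp

/-- Kato's smoothness criterion: if `‖T E(J)‖² ≤ C² |J|` for small `J ⊆ I`, then `T` is smooth
relative to the energy on `I`. -/
theorem lintegral_norm_evolution_le (hI : MeasurableSet I) {β : ℝ}
    (hIβ : I ⊆ Icc 0 β) (T : L2 s →L[ℂ] L2 s) {C : ℝ}
    (hT : ∀ δ, 0 < δ → ∀ k,
      ‖T ∘L energyProj m p (cell I δ k) (measurableSet_cell hI δ k)‖ ≤ C * √δ)
    (f : L2 s) :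
    ∫⁻ τ : ℝ, ‖T (energyGroup m p τ (energyProj m p I hI f))‖ₑ ^ 2 ≤
      ENNReal.ofReal (2 * π * C ^ 2 * ‖f‖ ^ 2) := by
  let δ : ℕ → ℝ := fun n => 1 / ((n : ℝ) + 1)
  have hδ (n : ℕ) : 0 < δ n := Nat.one_div_pos_of_nat
  have hδ0 : Filter.Tendsto δ Filter.atTop (nhds 0) := tendsto_one_div_add_atTop_nhds_zero_nat
  -- Each approximation is cut off to one of its own periods; these windows exhaust ℝ as δ n → 0, so
  -- Fatou's lemma applies to the whole line.
  let F : ℕ → ℝ → ℝ≥0∞ := fun n => (Ioc (-(π / δ n)) (π / δ n)).indicator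
    fun τ => ‖T (steppedEvolution m p hI β (δ n) τ f)‖ₑ ^ 2
  have hmeas (n : ℕ) : Measurable (F n) := by
    have hc : Continuous fun τ => T (steppedEvolution m p hI β (δ n) τ f) := by
      simp only [steppedEvolution, sum_apply, smul_apply]
      fun_prop
    exact (hc.enorm.measurable.pow_const 2).indicator measurableSet_Ioc
  have hlim (τ : ℝ) : Filter.Tendsto (fun n => F n τ) Filter.atTop
      (nhds (‖T (energyGroup m p τ (energyProj m p I hI f))‖ₑ ^ 2)) := by
    have h1 : Filter.Tendsto (fun n => T (steppedEvolution m p hI β (δ n) τ f)) Filter.atTop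
        (nhds (T (energyGroup m p τ (energyProj m p I hI f)))) := by
      refine (T.continuous.tendsto _).comp ?_
      rw [tendsto_iff_norm_sub_tendsto_zero]
      refine squeeze_zero (g := fun n => |τ| * δ n * ‖f‖) (fun _ => norm_nonneg _) (fun n => ?_)
        (by simpa using (hδ0.const_mul |τ|).mul_const ‖f‖)
      rw [norm_sub_rev]
      exact ContinuousLinearMap.le_of_opNorm_le _
        (norm_evolution_sub_steppedEvolution_le m p hI (hδ n) hIβ τ) f
    have h2 : ∀ᶠ n in Filter.atTop, τ ∈ Ioc (-(π / δ n)) (π / δ n) := by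
      have h3 : Filter.Tendsto (fun n => π / δ n) Filter.atTop Filter.atTop := by
        simp only [δ, div_div_eq_mul_div, div_one]
        exact (Filter.tendsto_atTop_add_const_right _ 1 tendsto_natCast_atTop_atTop).const_mul_atTop
          pi_pos
      filter_upwards [h3.eventually_gt_atTop |τ|] with n hn
      rw [abs_lt] at hn
      exact ⟨hn.1, hn.2.le⟩
    refine Filter.Tendsto.congr' ?_ ((ENNReal.continuous_pow 2).tendsto _ |>.comp
      ((continuous_enorm.tendsto _).comp h1))
    filter_upwards [h2] with n hn
    simp only [F, indicator_of_mem hn, Function.comp_apply]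
  calc _ = ∫⁻ τ : ℝ, Filter.liminf (fun n => F n τ) Filter.atTop :=
        lintegral_congr fun τ => (hlim τ).liminf_eq.symm
    _ ≤ Filter.liminf (fun n => ∫⁻ τ, F n τ) Filter.atTop := lintegral_liminf_le hmeas
    _ ≤ Filter.liminf (fun _ : ℕ => ENNReal.ofReal (2 * π * C ^ 2 * ‖f‖ ^ 2)) Filter.atTop :=
        Filter.liminf_le_liminf (Filter.Eventually.of_forall fun n => by
          simp only [F]
          rw [lintegral_indicator measurableSet_Ioc]
          exact lintegral_norm_steppedEvolution_le m p hI (hδ n) hIβ T (hT _ (hδ n)) f)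
    _ = _ := Filter.liminf_const _

end Kato

end TwoParticle

/-! ### Conclusion -/

theorem mainTheorem6 (s : ℕ) (m : ℝ) (hm : 0 < m) (ε : ℝ) (hε : 0 < ε) (β : ℝ)
    (θ : ℝ → ℝ) (hθ : ContDiff ℝ ∞ θ) (hθc : HasCompactSupport θ) (hθs : tsupport θ ⊆ Set.Ioi 0)
    (hθ1 : ∀ x ∈ Set.Ioo (ε / 2) (β + 1), θ x = 1) (ν : ℝ) (hν : 1 / 2 < ν) :
    ∃ c : EuclideanSpace ℝ (Fin s) → ℝ≥0,
      (∀ (p : EuclideanSpace ℝ (Fin s)) (f : TwoParticle.L2 s),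
        ∫⁻ τ : ℝ, ‖TwoParticle.japaneseNegPow (TwoParticle.dilation m θ p) ν
          (TwoParticle.energyGroup m p τ
            (TwoParticle.energyProj m p
              (Set.Icc (2 * TwoParticle.omega m ((1 / 2 : ℝ) • p) + ε) β) measurableSet_Icc
              f))‖ₑ ^ 2 ≤ c p * ‖f‖ₑ ^ 2) ∧
      ∀ K : Set (EuclideanSpace ℝ (Fin s)), IsCompact K → BddAbove (c '' K) := by
  obtain ⟨C, hC0, hC⟩ := TwoParticle.exists_norm_comp_japaneseNegPow_le (TwoParticle.L2 s) hν
  obtain ⟨M, hM⟩ := hθ.continuous.bounded_above_of_compact_support hθc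
  have hM0 : 0 ≤ M := (norm_nonneg _).trans (hM 0)
  -- The interpolation constant C is uniform over all operators A and M only involves θ, so this
  -- value serves for every p.
  refine ⟨fun _ => Real.toNNReal (2 * π * (C * √(8 * M)) ^ 2), fun p f => ?_, fun K _ =>
    ⟨_, by rintro _ ⟨_, -, rfl⟩; exact le_rfl⟩⟩
  have hω := TwoParticle.omega_pos hm ((1 / 2 : ℝ) • p)
  set I := Set.Icc (2 * TwoParticle.omega m ((1 / 2 : ℝ) • p) + ε) β with hI
  have hIβ : I ⊆ Icc 0 β := Icc_subset_Icc_left (by linarith)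
  refine (TwoParticle.lintegral_norm_evolution_le m p measurableSet_Icc hIβ _
    (C := C * √(8 * M)) (fun δ hδ k => ?_) f).trans_eq ?_
  · have hJ := TwoParticle.measurableSet_cell (I := I) measurableSet_Icc δ k
    have h := hC (TwoParticle.dilation m θ p) (TwoParticle.energyProj m p _ hJ) (8 * M * δ)
      (by positivity) fun w hw => TwoParticle.norm_energyProj_fst_sq_le hm hθ hθc hθs hM p hJ hδ
        (TwoParticle.cell_subset_closedBall hδ hIβ k)
        -- On I the shifted energy x − 2ω(p/2) lies in [ε, β − 2ω(p/2)], inside (ε/2, β + 1) because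
        -- ω > 0.
        (fun x hx => hθ1 _ ⟨by linarith [hx.1.1], by linarith [hx.1.2]⟩) hw
    have hsa : IsSelfAdjoint (TwoParticle.japaneseNegPow (TwoParticle.dilation m θ p) ν) :=
      cfc_predicate _ _
    -- Interpolation bounds E⟨A⟩^{-ν}, Kato's criterion needs ⟨A⟩^{-ν}E; both factors are
    -- self-adjoint, so these are adjoints of equal norm.
    rw [← norm_star]
    change ‖star (TwoParticle.japaneseNegPow (TwoParticle.dilation m θ p) ν *
      TwoParticle.energyProj m p _ hJ)‖ ≤ _
    rw [star_mul, hsa.star_eq, (TwoParticle.isSelfAdjoint_energyProj m p hJ).star_eq]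
    rw [Real.sqrt_mul (by positivity)] at h
    rw [mul_assoc]
    exact h
  · rw [ENNReal.ofReal_mul (by positivity), ENNReal.ofReal_pow (norm_nonneg _), ofReal_norm]
    rfl
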